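/- Let $k$ be a field and let $(H,R)$ be a semisimple and cosemisimple quasi-triangular Hopf algebra over $k$, with antipode $S$ and $R=\sum R^1\otimes R^2$. Write $h\cdot_{ad}a=\sum h_{(1)}\,a\,S(h_{(2)})$ for the left adjoint action, and let $H_R$ be the transmuted braided group, i.e. $H$ with the comultiplication $\Delta_R(h)=\sum h_{(1)}S(R^2)\otimes (R^1\cdot_{ad}h_{(2)})$ and the counit $\varepsilon$. Let $D$ be a minimal $H$-adjoint-stable subcoalgebra of $H_R$ (a minimal one among the nonzero subspaces $C\subseteq H$ with $\Delta_R(C)\subseteq C\otimes C$ and $H\cdot_{ad}C\subseteq C$). Let ${}^D_H\mathcal M$ be the category of left $H$-modules $V$ with a left $D$-comodule structure $\rho(v)=\sum v^{\langle -1\rangle}\otimes v^{\langle 0\rangle}\in D\otimes V$ such that $\rho(hv)=\sum (h_{(1)}\cdot_{ad}v^{\langle -1\rangle})\otimes h_{(2)}v^{\langle 0\rangle}$; its morphisms are the $H$-linear and $D$-colinear maps. For a finite dimensional left $D$-comodule $W$, let $H\otimes W$ be the comodule with coaction $h\otimes w\mapsto\sum (h_{(1)}\cdot_{ad}w^{\langle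 -1\rangle})\otimes h_{(2)}\otimes w^{\langle 0\rangle}$, and let $N_W=W^*\square_D(H\otimes W)$ be the cotensor product, an algebra with the product $$\Big(\sum_j w_j'^*\otimes g_j\otimes w_j''\Big)\circ\Big(\sum_i w_i^*\otimes h_i\otimes w_i'\Big)=\sum_{i,j}w_i^*\otimes h_ig_j\otimes\langle w_j'^*,w_i'\rangle w_j''.$$ Suppose that $D$ contains a grouplike element $g$ of $H_R$ (that is, $\Delta_R(g)=g\otimes g$ and $\varepsilon(g)=1$), and let $W=kg$, with coaction $\Delta_R|_W$. 1. The map $w^*\otimes h\otimes w\mapsto\langle w^*,w\rangle h$ restricts to a bijection from $N_W$ onto $$\Big\{h\in H:\ \sum (h_{(1)}\cdot_{ad}g)\otimes h_{(2)}=g\otimes h\Big\},$$ which is a right coideal subalgebra of $H$. Under this identification $x\circ y=yx$, so that $N_W$ as an algebra is the opposite algebra of this subalgebra of $H$. 2. Let $x\in N_W$ act on $H$ from the left by $x\cdot h=hx$. For each right $N_W$-module $U$, the operations $h'\cdot(u\otimes h)=u\otimes h'h$ and $\rho(u\otimes h)=\sum (h_{(1)}\cdot_{ad}g)\otimes(u\otimes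 h_{(2)})$ make $U\otimes_{N_W}H$ an object of ${}^D_H\mathcal M$. 3. If $U$ is an irreducible right $N_W$-module, then $U\otimes_{N_W}H$ is an irreducible object of ${}^D_H\mathcal M$. Conversely, every irreducible object of ${}^D_H\mathcal M$ is isomorphic to $U\otimes_{N_W}H$ for some irreducible right $N_W$-module $U$. -/

import Mathlib

universe u v w

open scoped TensorProduct
open Coalgebra (comul counit)

noncomputable section

namespace RelYD

/-! ### The adjoint action and the transmuted comultiplication -/

section Hopf

variable (k : Type*) {H : Type*} [Field k] [Ring H] [HopfAlgebra k H]

/-- The left adjoint action `h ·_ad a = ∑ h₁ a S(h₂)`, as an algebra map `H → End_k(H)`. -/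
def adAction : H →ₐ[k] Module.End k H :=
  (AlgHom.mulLeftRight k H).comp
    ((Algebra.TensorProduct.map (AlgHom.id k H) (HopfAlgebra.antipodeAlgHomOp k H)).comp
      (Bialgebra.comulAlgHom k H))

/-- The action of `H` on `H ⊗ X`, for a left `H`-module `X`, given by
`h · (a ⊗ x) = ∑ (h₁ ·_ad a) ⊗ h₂ x`. -/
def diagAction (X : Type*) [AddCommGroup X] [Module k X] [Module H X] [IsScalarTower k H X] :
    H →ₐ[k] Module.End k (H ⊗[k] X) :=
  (Module.endTensorEndAlgHom (R := k) (A := k) (M := H) (N := X)).comp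
    ((Algebra.TensorProduct.map (adAction k) (Algebra.lsmul k k X)).comp
      (Bialgebra.comulAlgHom k H))

variable {k}

/-- A quasi-triangular structure on `H`: an invertible `R ∈ H ⊗ H` with
`R Δ(h) = Δ^cop(h) R`, `(Δ ⊗ id)(R) = R¹³ R²³` and `(id ⊗ Δ)(R) = R¹³ R¹²`. -/
structure IsQuasitriangular (R : H ⊗[k] H) : Prop where
  isUnit : IsUnit R
  mul_comul : ∀ h : H, R * comul h = TensorProduct.comm k H H (comul h) * R
  comul_left : TensorProduct.assoc k H H H ((comul (R := k)).rTensor H R) =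
    (TensorProduct.mk k H H 1).lTensor H R * TensorProduct.mk k H (H ⊗[k] H) 1 R
  comul_right : (comul (R := k)).lTensor H R =
    (TensorProduct.mk k H H 1).lTensor H R *
      TensorProduct.assoc k H H H ((TensorProduct.mk k (H ⊗[k] H) H).flip 1 R)

/-- The comultiplication of the transmuted braided group `H_R`,
`Δ_R(h) = ∑ h₁ S(R²) ⊗ (R¹ ·_ad h₂)`. -/
def transmutedComul (R : H ⊗[k] H) : H →ₗ[k] H ⊗[k] H :=
  TensorProduct.map
      (LinearMap.mul' k H ∘ₗ (HopfAlgebra.antipode k).lTensor H)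
      (TensorProduct.lift (adAction k).toLinearMap ∘ₗ (TensorProduct.comm k H H).toLinearMap) ∘ₗ
    (TensorProduct.tensorTensorTensorComm k H H H H).toLinearMap ∘ₗ
    (TensorProduct.mk k (H ⊗[k] H) (H ⊗[k] H)).flip (TensorProduct.comm k H H R) ∘ₗ
    comul

/-- `C` is a subcoalgebra with respect to the comultiplication `Δ`: `Δ(C) ⊆ C ⊗ C`. -/
def IsSubcoalgebra (Δ : H →ₗ[k] H ⊗[k] H) (C : Submodule k H) : Prop :=
  ∀ c ∈ C, Δ c ∈ LinearMap.range (TensorProduct.map C.subtype C.subtype)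

variable (k H) in
/-- `H` is cosemisimple: it is the sum of its simple (i.e. minimal nonzero) subcoalgebras. -/
def IsCosemisimple : Prop :=
  sSup {C : Submodule k H |
    Minimal (fun C' : Submodule k H => IsSubcoalgebra comul C' ∧ C' ≠ ⊥) C} = ⊤

/-- A minimal `H`-adjoint-stable subcoalgebra of `H_R`: minimal among the nonzero subcoalgebras of
`(H, Δ_R)` that are stable under the left adjoint action. -/
def IsMinimalAdjointStable (R : H ⊗[k] H) (D : Submodule k H) : Prop :=
  Minimal (fun C : Submodule k H => IsSubcoalgebra (transmutedComul R) C ∧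
    (∀ h : H, ∀ c ∈ C, adAction k h c ∈ C) ∧ C ≠ ⊥) D

/-- `g` is a grouplike element of the coalgebra `H_R`. -/
def IsTransmutedGroupLike (R : H ⊗[k] H) (g : H) : Prop :=
  counit (R := k) g = 1 ∧ transmutedComul R g = g ⊗ₜ[k] g

end Hopf

/-! ### The category of `D`-comodules in `H`-modules -/

section Objects

variable {k H : Type*} [Field k] [Ring H] [HopfAlgebra k H]

/-- The left `H`-module `V` with `ρ : V → H ⊗ V` is an object of `^D_H M`, the category of left
`D`-comodules in the category of left `H`-modules, for a subcoalgebra `D` of `H_R` which is stable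
under the adjoint action. -/
structure IsObject (R : H ⊗[k] H) (D : Submodule k H) {V : Type*} [AddCommGroup V] [Module k V]
    [Module H V] [IsScalarTower k H V] (ρ : V →ₗ[k] H ⊗[k] V) : Prop where
  coassoc : ∀ v, TensorProduct.assoc k H H V ((transmutedComul R).rTensor V (ρ v)) =
    ρ.lTensor H (ρ v)
  counit : ∀ v, TensorProduct.lid k V ((counit (R := k)).rTensor V (ρ v)) = v
  mem : ∀ v, ρ v ∈ LinearMap.range (D.subtype.rTensor V)
  smul : ∀ (h : H) (v : V), ρ (h • v) = diagAction k V h (ρ v)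

/-- Irreducibility of an object `(V, ρ)` of `^D_H M`: `V ≠ 0`, and the only `H`-submodules of `V`
which are subcomodules are `0` and `V`. -/
def IsIrreducible {V : Type*} [AddCommGroup V] [Module k V]
    [Module H V] [IsScalarTower k H V] (ρ : V →ₗ[k] H ⊗[k] V) : Prop :=
  Nontrivial V ∧ ∀ P : Submodule H V,
    (∀ v ∈ P, ρ v ∈ LinearMap.range ((P.restrictScalars k).subtype.lTensor H)) → P = ⊥ ∨ P = ⊤

/-- Isomorphism of objects of `^D_H M`: an `H`-linear bijection commuting with the coactions. -/
def Isomorphic {V V' : Type*} [AddCommGroup V] [Module k V] [Module H V] [IsScalarTower k H V]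
    [AddCommGroup V'] [Module k V'] [Module H V'] [IsScalarTower k H V']
    (ρ : V →ₗ[k] H ⊗[k] V) (ρ' : V' →ₗ[k] H ⊗[k] V') : Prop :=
  ∃ f : V ≃ₗ[H] V', ∀ v, (f.toLinearMap.restrictScalars k).lTensor H (ρ v) = ρ' (f v)

end Objects

/-! ### The algebra `W* ⊗ H ⊗ W` and the `R`-adjoint-stable algebra `N_W` -/

section NW

variable (k H W : Type*) [Field k] [Ring H] [HopfAlgebra k H] [AddCommGroup W] [Module k W]

/-- The space `W* ⊗ (H ⊗ W)`, which carries the product `∘` below. -/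
def DualHW : Type _ := Module.Dual k W ⊗[k] (H ⊗[k] W)

instance : AddCommGroup (DualHW k H W) :=
  inferInstanceAs (AddCommGroup (Module.Dual k W ⊗[k] (H ⊗[k] W)))

instance : Module k (DualHW k H W) :=
  inferInstanceAs (Module k (Module.Dual k W ⊗[k] (H ⊗[k] W)))

variable {k H W}

/-- The identity map `W* ⊗ (H ⊗ W) → W* ⊗ (H ⊗ W)`, as a map to the type with the product `∘`. -/
def DualHW.of : Module.Dual k W ⊗[k] (H ⊗[k] W) ≃ₗ[k] DualHW k H W := LinearEquiv.refl k _

/-- The canonical map `W* ⊗ (H ⊗ W) → Hom_k(W, H ⊗ W)`. -/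
def DualHW.toHom : DualHW k H W →ₗ[k] W →ₗ[k] H ⊗[k] W := dualTensorHom k W (H ⊗[k] W)

theorem DualHW.toHom_injective [FiniteDimensional k W] :
    Function.Injective (DualHW.toHom (k := k) (H := H) (W := W)) :=
  (dualTensorHom_bijective (R := k) (M := W) (N := H ⊗[k] W)).1

/-- The evaluation map: `(w* ⊗ h' ⊗ w') · (h ⊗ w) = ⟨w*, w⟩ h h' ⊗ w'`. -/
def DualHW.eval : DualHW k H W →ₗ[k] Module.End k (H ⊗[k] W) where
  toFun x := TensorProduct.lift
    (LinearMap.lcomp k (H ⊗[k] W) (DualHW.toHom x) ∘ₗ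
      (Algebra.lsmul k k (H ⊗[k] W) : H →ₐ[k] _).toLinearMap)
  map_add' x y := by ext; simp
  map_smul' c x := by
    apply TensorProduct.ext'
    intro h w
    simp only [TensorProduct.lift.tmul, LinearMap.comp_apply, LinearMap.lcomp_apply,
      AlgHom.toLinearMap_apply, Algebra.lsmul_coe, map_smul, LinearMap.smul_apply,
      RingHom.id_apply]

theorem DualHW.eval_tmul (x : DualHW k H W) (h : H) (w : W) :
    DualHW.eval x (h ⊗ₜ w) = h • DualHW.toHom x w := rfl

theorem DualHW.eval_smul (x : DualHW k H W) (h : H) (m : H ⊗[k] W) :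
    DualHW.eval x (h • m) = h • DualHW.eval x m := by
  induction m with
  | zero => simp
  | add a b ha hb => rw [smul_add, map_add, map_add, smul_add, ha, hb]
  | tmul a w => rw [TensorProduct.smul_tmul', DualHW.eval_tmul, DualHW.eval_tmul, smul_eq_mul,
      mul_smul]

/-- The product `x ∘ y = ∑ w* ⊗ h h' ⊗ ⟨w'*, w⟩ w'` of `x = ∑ w'* ⊗ h' ⊗ w'` and
`y = ∑ w* ⊗ h ⊗ w`. -/
instance : Mul (DualHW k H W) where
  mul x y := (DualHW.eval x).lTensor (Module.Dual k W) y

theorem DualHW.mul_def (x y : DualHW k H W) :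
    x * y = (DualHW.eval x).lTensor (Module.Dual k W) y := rfl

/-- The product on pure tensors. -/
theorem DualHW.tmul_mul_tmul (a b : Module.Dual k W) (h h' : H) (w w' : W) :
    DualHW.of (b ⊗ₜ (h' ⊗ₜ w')) * DualHW.of (a ⊗ₜ (h ⊗ₜ w)) =
      DualHW.of (a ⊗ₜ ((h * h') ⊗ₜ (b w • w'))) := by
  change a ⊗ₜ[k] (h • (b w • (h' ⊗ₜ[k] w'))) = a ⊗ₜ[k] ((h * h') ⊗ₜ[k] (b w • w'))
  rw [← TensorProduct.tmul_smul, TensorProduct.smul_tmul', smul_eq_mul]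

theorem DualHW.toHom_mul (x y : DualHW k H W) (w : W) :
    DualHW.toHom (x * y) w = DualHW.eval x (DualHW.toHom y w) := by
  have := LinearMap.congr_fun (dualTensorHom_comp_lTensor (R := k) (M := W) (DualHW.eval x)) y
  exact LinearMap.congr_fun this w

theorem DualHW.eval_mul (x y : DualHW k H W) (m : H ⊗[k] W) :
    DualHW.eval (x * y) m = DualHW.eval x (DualHW.eval y m) := by
  induction m with
  | zero => simp
  | add a b ha hb => simp only [map_add, ha, hb]
  | tmul a w => rw [DualHW.eval_tmul, DualHW.eval_tmul, DualHW.toHom_mul, DualHW.eval_smul]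

variable [FiniteDimensional k W]

/-- The identity `∑ wᵢ* ⊗ 1 ⊗ wᵢ`, where `wᵢ`, `wᵢ*` are dual bases; it is the element that
corresponds to the map `w ↦ 1 ⊗ w`. -/
instance : One (DualHW k H W) where
  one := (dualTensorHomEquiv k W (H ⊗[k] W)).symm (TensorProduct.mk k H W 1)

theorem DualHW.toHom_one (w : W) : DualHW.toHom (1 : DualHW k H W) w = 1 ⊗ₜ w :=
  LinearMap.congr_fun
    ((dualTensorHomEquiv k W (H ⊗[k] W)).apply_symm_apply (TensorProduct.mk k H W 1)) w

instance : Ring (DualHW k H W) where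
  __ := (inferInstance : AddCommGroup (DualHW k H W))
  mul := (· * ·)
  one := 1
  left_distrib x y z := map_add ((DualHW.eval x).lTensor (Module.Dual k W)) y z
  right_distrib x y z := by
    rw [DualHW.mul_def, map_add, LinearMap.lTensor_add]; rfl
  zero_mul x := by rw [DualHW.mul_def, map_zero, LinearMap.lTensor_zero]; rfl
  mul_zero x := map_zero ((DualHW.eval x).lTensor (Module.Dual k W))
  mul_assoc x y z := by
    apply DualHW.toHom_injective
    ext w
    simp only [DualHW.toHom_mul, DualHW.eval_mul]
  one_mul x := by
    have h : ∀ m, DualHW.eval (1 : DualHW k H W) m = m := fun m => by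
      induction m with
      | zero => simp
      | add a b ha hb => rw [map_add, ha, hb]
      | tmul a w => rw [DualHW.eval_tmul, DualHW.toHom_one, TensorProduct.smul_tmul', smul_eq_mul,
          mul_one]
    apply DualHW.toHom_injective
    ext w
    rw [DualHW.toHom_mul, h]
  mul_one x := by
    apply DualHW.toHom_injective
    ext w
    rw [DualHW.toHom_mul, DualHW.toHom_one, DualHW.eval_tmul, one_smul]

instance : Algebra k (DualHW k H W) :=
  Algebra.ofModule
    (fun c x y => by
      rw [DualHW.mul_def, DualHW.mul_def, map_smul, LinearMap.lTensor_smul]; rfl)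
    (fun c x y => map_smul ((DualHW.eval x).lTensor (Module.Dual k W)) c y)

/-- The right coaction on `W*` induced by a left coaction `ρ` on `W`: it is determined by
`∑ ⟨(w*)⁰, w⟩ (w*)¹ = ∑ w⁻¹ ⟨w*, w⁰⟩`. -/
def dualCoaction (ρ : W →ₗ[k] H ⊗[k] W) : Module.Dual k W →ₗ[k] Module.Dual k W ⊗[k] H :=
  (dualTensorHomEquiv k W H).symm.toLinearMap ∘ₗ
    LinearMap.lcomp k H ρ ∘ₗ
    LinearMap.compRight k (TensorProduct.rid k H).toLinearMap ∘ₗ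
    LinearMap.lTensorHom (R := k) (N := W) (P := k) H

/-- The left coaction on `H ⊗ W` induced by a left coaction on `W`:
`h ⊗ w ↦ ∑ (h₁ ·_ad w⁻¹) ⊗ h₂ ⊗ w⁰` (the action of `h` on `∑ w⁻¹ ⊗ (1 ⊗ w⁰)`). -/
def freeCoaction {W : Type*} [AddCommGroup W] [Module k W] (ρ : W →ₗ[k] H ⊗[k] W) :
    H ⊗[k] W →ₗ[k] H ⊗[k] (H ⊗[k] W) :=
  TensorProduct.lift
    (LinearMap.lcomp k (H ⊗[k] (H ⊗[k] W)) ((TensorProduct.mk k H W 1).lTensor H ∘ₗ ρ) ∘ₗ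
      (diagAction k (H ⊗[k] W)).toLinearMap)

/-- The cotensor product `M □ X` of a right comodule `(M, α)` and a left comodule `(X, β)`. -/
def cotensor {M X : Type*} [AddCommGroup M] [Module k M] [AddCommGroup X] [Module k X]
    (α : M →ₗ[k] M ⊗[k] H) (β : X →ₗ[k] H ⊗[k] X) : Submodule k (M ⊗[k] X) :=
  LinearMap.eqLocus ((TensorProduct.assoc k M H X).toLinearMap ∘ₗ α.rTensor X) (β.lTensor M)

theorem freeCoaction_tmul {W : Type*} [AddCommGroup W] [Module k W] (ρ : W →ₗ[k] H ⊗[k] W)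
    (h : H) (w : W) :
    freeCoaction ρ (h ⊗ₜ w) =
      diagAction k (H ⊗[k] W) h ((TensorProduct.mk k H W 1).lTensor H (ρ w)) := rfl

theorem freeCoaction_smul {W : Type*} [AddCommGroup W] [Module k W] (ρ : W →ₗ[k] H ⊗[k] W)
    (h : H) (m : H ⊗[k] W) :
    freeCoaction ρ (h • m) = diagAction k (H ⊗[k] W) h (freeCoaction ρ m) := by
  induction m with
  | zero => simp
  | add a b ha hb => rw [smul_add, map_add, map_add, map_add, ha, hb]
  | tmul a w => rw [TensorProduct.smul_tmul', freeCoaction_tmul, freeCoaction_tmul, smul_eq_mul,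
      map_mul, Module.End.mul_apply]

/-- `diagAction` commutes with maps induced by `H`-linear maps. -/
theorem diagAction_lTensor {X Y : Type*} [AddCommGroup X] [Module k X] [Module H X]
    [IsScalarTower k H X] [AddCommGroup Y] [Module k Y] [Module H Y] [IsScalarTower k H Y]
    (f : X →ₗ[k] Y) (hf : ∀ (h : H) (x : X), f (h • x) = h • f x) (h : H) (t : H ⊗[k] X) :
    f.lTensor H (diagAction k X h t) = diagAction k Y h (f.lTensor H t) := by
  simp only [diagAction, AlgHom.comp_apply]
  generalize Bialgebra.comulAlgHom k H h = d
  induction d with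
  | zero => simp
  | add a b ha hb => simp only [map_add, LinearMap.add_apply, ha, hb]
  | tmul a b =>
    induction t with
    | zero => simp
    | add p q hp hq => simp only [map_add, hp, hq]
    | tmul p q => simp [Module.endTensorEndAlgHom_apply, hf]

theorem dualTensorHom_assoc_dualCoaction {X : Type*} [AddCommGroup X] [Module k X]
    (ρ : W →ₗ[k] H ⊗[k] W) (x : Module.Dual k W ⊗[k] X) (w : W) :
    dualTensorHom k W (H ⊗[k] X)
        (TensorProduct.assoc k (Module.Dual k W) H X ((dualCoaction ρ).rTensor X x)) w =
      (dualTensorHom k W X x).lTensor H (ρ w) := by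
  induction x with
  | zero => simp
  | add a b ha hb => simp only [map_add, LinearMap.add_apply, ha, hb, LinearMap.lTensor_add]
  | tmul a y =>
    have h1 : ∀ t : Module.Dual k W ⊗[k] H, dualTensorHom k W (H ⊗[k] X)
        (TensorProduct.assoc k (Module.Dual k W) H X (t ⊗ₜ y)) w =
        dualTensorHom k W H t w ⊗ₜ y := fun t => by
      induction t with
      | zero => simp
      | add a b ha hb => simp only [map_add, LinearMap.add_apply, TensorProduct.add_tmul, ha, hb]
      | tmul b h => simp [TensorProduct.smul_tmul']
    have h2 : dualTensorHom k W H (dualCoaction ρ a) w =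
        TensorProduct.rid k H (a.lTensor H (ρ w)) :=
      LinearMap.congr_fun ((dualTensorHomEquiv k W H).apply_symm_apply _) w
    rw [LinearMap.rTensor_tmul, h1, h2]
    generalize ρ w = r
    induction r with
    | zero => simp
    | add p q hp hq => simp only [map_add, TensorProduct.add_tmul, hp, hq]
    | tmul p q => simp [TensorProduct.smul_tmul]

/-- An element of `W* ⊗ (H ⊗ W)` lies in `W* □ (H ⊗ W)` if and only if the corresponding map
`W → H ⊗ W` is a comodule map. -/
theorem mem_cotensor_iff (ρ : W →ₗ[k] H ⊗[k] W) (x : DualHW k H W) :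
    DualHW.of.symm x ∈ cotensor (dualCoaction ρ) (freeCoaction ρ) ↔
      ∀ w, freeCoaction ρ (DualHW.toHom x w) = (DualHW.toHom x).lTensor H (ρ w) := by
  have hinj := (dualTensorHom_bijective (R := k) (M := W) (N := H ⊗[k] (H ⊗[k] W))).1
  have h3 : ∀ w, dualTensorHom k W (H ⊗[k] (H ⊗[k] W))
      ((freeCoaction ρ).lTensor (Module.Dual k W) (DualHW.of.symm x)) w =
      freeCoaction ρ (DualHW.toHom x w) := fun w =>
    LinearMap.congr_fun (LinearMap.congr_fun
      (dualTensorHom_comp_lTensor (R := k) (M := W) (freeCoaction ρ)) x) w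
  rw [cotensor, LinearMap.mem_eqLocus, ← hinj.eq_iff, LinearMap.ext_iff]
  refine forall_congr' fun w => ?_
  rw [h3]
  exact (Eq.congr_left (dualTensorHom_assoc_dualCoaction ρ x w)).trans eq_comm

/-- The `R`-adjoint-stable algebra `N_W = W* □_D (H ⊗ W)` of a finite dimensional left
`D`-comodule `W`, with the product `∘`. -/
def adjointStableAlgebra (ρ : W →ₗ[k] H ⊗[k] W) : Subalgebra k (DualHW k H W) where
  carrier := {x | DualHW.of.symm x ∈ cotensor (dualCoaction ρ) (freeCoaction ρ)}
  add_mem' ha hb := (cotensor (dualCoaction ρ) (freeCoaction ρ)).add_mem ha hb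
  algebraMap_mem' c := by
    rw [Algebra.algebraMap_eq_smul_one]
    refine (cotensor (dualCoaction ρ) (freeCoaction ρ)).smul_mem c
      ((mem_cotensor_iff ρ (1 : DualHW k H W)).2 fun w => ?_)
    have h : DualHW.toHom (1 : DualHW k H W) = TensorProduct.mk k H W 1 :=
      LinearMap.ext fun w => DualHW.toHom_one w
    rw [DualHW.toHom_one, h, freeCoaction_tmul, map_one, Module.End.one_apply]
  mul_mem' {x y} hx hy := by
    rw [Set.mem_ofPred_eq, mem_cotensor_iff] at *
    have hx' : ∀ m, freeCoaction ρ (DualHW.eval x m) =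
        (DualHW.eval x).lTensor H (freeCoaction ρ m) := fun m => by
      induction m with
      | zero => simp
      | add a b ha hb => simp only [map_add, ha, hb]
      | tmul a w =>
        rw [DualHW.eval_tmul, freeCoaction_smul, hx, freeCoaction_tmul,
          diagAction_lTensor _ (DualHW.eval_smul x)]
        have h : DualHW.toHom x = DualHW.eval x ∘ₗ TensorProduct.mk k H W 1 := by
          ext v
          simp [DualHW.eval_tmul]
        rw [h, LinearMap.lTensor_comp, LinearMap.comp_apply]
    intro w
    have h : DualHW.toHom (x * y) = DualHW.eval x ∘ₗ DualHW.toHom y :=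
      LinearMap.ext fun w => DualHW.toHom_mul x y w
    rw [h, LinearMap.comp_apply, hx', hy, LinearMap.lTensor_comp, LinearMap.comp_apply]

end NW

/-! ### The case `W = k g` and the induced objects `U ⊗_{N_W} H` -/

section Line

variable {k H : Type*} [Field k] [Ring H] [HopfAlgebra k H]

/-- The contraction `W* ⊗ (H ⊗ W) → H`, `w* ⊗ h ⊗ w ↦ ⟨w*, w⟩ h`. -/
def DualHW.contract {W : Type*} [AddCommGroup W] [Module k W] : DualHW k H W →ₗ[k] H :=
  TensorProduct.lift
    (LinearMap.compRight k (TensorProduct.rid k H).toLinearMap ∘ₗ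
      LinearMap.lTensorHom (R := k) (N := W) (P := k) H) ∘ₗ DualHW.of.symm.toLinearMap

theorem DualHW.contract_of {W : Type*} [AddCommGroup W] [Module k W] (a : Module.Dual k W) (h : H)
    (w : W) : DualHW.contract (DualHW.of (a ⊗ₜ[k] (h ⊗ₜ[k] w))) = a w • h := rfl

variable (k) in
/-- The coaction `w ↦ g ⊗ w` on the line `W = k g`. -/
def lineCoaction (g : H) : (k ∙ g) →ₗ[k] H ⊗[k] (k ∙ g) := TensorProduct.mk k H (k ∙ g) g

/-- If `g` is grouplike in `H_R`, the coaction on `k g` is the restriction of `Δ_R`. -/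
theorem lineCoaction_eq {R : H ⊗[k] H} {g : H} (hg : IsTransmutedGroupLike R g) (w : k ∙ g) :
    (k ∙ g).subtype.lTensor H (lineCoaction k g w) = transmutedComul R w := by
  obtain ⟨w, hw⟩ := w
  obtain ⟨c, rfl⟩ := Submodule.mem_span_singleton.1 hw
  simp [lineCoaction, hg.2]

variable (k) in
/-- The `R`-adjoint-stable algebra `N_W` for `W = k g`. -/
abbrev NLine (g : H) : Subalgebra k (DualHW k H (k ∙ g)) := adjointStableAlgebra (lineCoaction k g)

theorem diagAction_tmul_mul (g h x : H) :
    diagAction k H h (g ⊗ₜ x) =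
      (LinearMap.mulRight k x).lTensor H
        (((adAction k).toLinearMap.flip g).rTensor H (comul h)) := by
  simp only [diagAction, AlgHom.comp_apply, Bialgebra.comulAlgHom_apply]
  generalize comul (R := k) h = d
  induction d with
  | zero => simp
  | add a b ha hb => simp only [map_add, LinearMap.add_apply, ha, hb]
  | tmul a b => simp [Module.endTensorEndAlgHom_apply]

variable (k) in
/-- The set `{h ∈ H : ∑ (h₁ ·_ad g) ⊗ h₂ = g ⊗ h}`, as a subalgebra of `H`. -/
def adStabilizer (g : H) : Subalgebra k H where
  carrier := {h | ((adAction k).toLinearMap.flip g).rTensor H (comul h) = g ⊗ₜ h}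
  add_mem' {a b} ha hb := by
    rw [Set.mem_ofPred_eq] at *
    rw [map_add, map_add, ha, hb, TensorProduct.tmul_add]
  algebraMap_mem' c := by
    rw [Set.mem_ofPred_eq, Algebra.algebraMap_eq_smul_one, map_smul, map_smul,
      Bialgebra.comul_one, Algebra.TensorProduct.one_def, LinearMap.rTensor_tmul]
    simp
  mul_mem' {a b} ha hb := by
    have key : ∀ h : H, ((adAction k).toLinearMap.flip g).rTensor H (comul h) = g ⊗ₜ h →
        ∀ x : H, diagAction k H h (g ⊗ₜ x) = g ⊗ₜ (h * x) := fun h hh x => by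
      rw [diagAction_tmul_mul, hh]; simp
    have h1 := diagAction_tmul_mul (k := k) g (a * b) 1
    rw [map_mul, Module.End.mul_apply, key b hb, key a ha, LinearMap.mulRight_one,
      LinearMap.lTensor_id, LinearMap.id_apply, mul_one] at h1
    exact h1.symm

theorem contract_mem_adStabilizer (g : H) (x : NLine k g) :
    DualHW.contract (x : DualHW k H (k ∙ g)) ∈ adStabilizer k g := by
  obtain ⟨x, hx⟩ := x
  change ((adAction k).toLinearMap.flip g).rTensor H (comul (DualHW.contract x)) =
    g ⊗ₜ DualHW.contract x
  have hd : ∀ a : Module.Dual k (k ∙ g), dualCoaction (lineCoaction k g) a = a ⊗ₜ g := fun a => by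
    apply (dualTensorHom_bijective (R := k) (M := (k ∙ g)) (N := H)).1
    ext w
    have h2 : dualTensorHom k (k ∙ g) H (dualCoaction (lineCoaction k g) a) w =
        TensorProduct.rid k H (a.lTensor H (lineCoaction k g w)) :=
      LinearMap.congr_fun ((dualTensorHomEquiv k (k ∙ g) H).apply_symm_apply _) w
    rw [h2]
    simp [lineCoaction]
  let c : Module.Dual k (k ∙ g) →ₗ[k] H ⊗[k] (k ∙ g) →ₗ[k] H :=
    LinearMap.compRight k (TensorProduct.rid k H).toLinearMap ∘ₗ
      LinearMap.lTensorHom (R := k) (N := (k ∙ g)) (P := k) H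
  have hc : ∀ a (h : H) w, c a (h ⊗ₜ w) = a w • h := fun a h w => rfl
  have hcs : ∀ a (h : H) m, c a (h • m) = h • c a m := fun a h m => by
    induction m with
    | zero => simp
    | add p q hp hq => rw [smul_add, map_add, map_add, smul_add, hp, hq]
    | tmul p w => rw [TensorProduct.smul_tmul', hc, hc, smul_eq_mul, smul_eq_mul, mul_smul_comm]
  let T : Module.Dual k (k ∙ g) ⊗[k] (H ⊗[k] (H ⊗[k] (k ∙ g))) →ₗ[k] H ⊗[k] H :=
    TensorProduct.lift (LinearMap.lTensorHom (R := k) H ∘ₗ c)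
  have hT : ∀ a m, T (a ⊗ₜ m) = (c a).lTensor H m := fun a m => rfl
  have hC : ∀ a m, DualHW.contract (DualHW.of (a ⊗ₜ[k] m)) = c a m := fun a m => rfl
  have h1 : ∀ y, T (TensorProduct.assoc k _ H _
      ((dualCoaction (lineCoaction k g)).rTensor (H ⊗[k] (k ∙ g)) y)) =
        g ⊗ₜ DualHW.contract (DualHW.of y) := fun y => by
    induction y with
    | zero => simp
    | add p q hp hq => simp only [map_add, hp, hq, TensorProduct.tmul_add]
    | tmul a m => rw [LinearMap.rTensor_tmul, hd, TensorProduct.assoc_tmul, hT, hC,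
        LinearMap.lTensor_tmul]
  have h2 : ∀ y, T ((freeCoaction (lineCoaction k g)).lTensor _ y) =
      ((adAction k).toLinearMap.flip g).rTensor H
        (comul (DualHW.contract (DualHW.of y))) := fun y => by
    induction y with
    | zero => simp
    | add p q hp hq => simp only [map_add, hp, hq]
    | tmul a m =>
      rw [LinearMap.lTensor_tmul, hT, hC]
      induction m with
      | zero => simp
      | add p q hp hq => simp only [map_add, hp, hq]
      | tmul h w =>
        rw [freeCoaction_tmul, diagAction_lTensor _ (hcs a), hc, lineCoaction,
          TensorProduct.mk_apply, LinearMap.lTensor_tmul, LinearMap.lTensor_tmul,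
          TensorProduct.mk_apply, hc, TensorProduct.tmul_smul, map_smul, diagAction_tmul_mul,
          LinearMap.mulRight_one, LinearMap.lTensor_id, LinearMap.id_apply, map_smul, map_smul]
  have hx0 : TensorProduct.assoc k _ H _ ((dualCoaction (lineCoaction k g)).rTensor
      (H ⊗[k] (k ∙ g)) (DualHW.of.symm x)) =
      (freeCoaction (lineCoaction k g)).lTensor _ (DualHW.of.symm x) := hx
  have h3 := congrArg T hx0
  exact (h2 (DualHW.of.symm x)).symm.trans (h3.symm.trans (h1 (DualHW.of.symm x)))

/-- The relations `(u · x) ⊗ h = u ⊗ (x · h)` of `U ⊗_{N_W} H`, where `x ∈ N_W` acts on `H` from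
the left by right multiplication with the element of `H` that corresponds to `x`. The tensor factors
are written in the opposite order, so that the left `H`-action is the one on the left factor. -/
def inducedRel (g : H) (U : Type*) [AddCommGroup U] [Module k U] [Module (NLine k g)ᵐᵒᵖ U] :
    Submodule H (H ⊗[k] U) :=
  Submodule.span H {z | ∃ (h : H) (x : NLine k g) (u : U),
    z = h ⊗ₜ[k] (MulOpposite.op x • u) -
      (h * DualHW.contract (x : DualHW k H (k ∙ g))) ⊗ₜ[k] u}

variable (k) in
/-- The left `H`-module `U ⊗_{N_W} H` for `W = k g` and a right `N_W`-module `U`; the class of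
`h ⊗ u` is the element `u ⊗ h`, and `h' · (u ⊗ h) = u ⊗ h' h`. -/
abbrev Induced (g : H) (U : Type*) [AddCommGroup U] [Module k U] [Module (NLine k g)ᵐᵒᵖ U] :
    Type _ := (H ⊗[k] U) ⧸ inducedRel (k := k) g U

/-- The map `h ⊗ u ↦ ∑ (h₁ ·_ad g) ⊗ (u ⊗ h₂)`. -/
def preInducedCoaction (g : H) (U : Type*) [AddCommGroup U] [Module k U]
    [Module (NLine k g)ᵐᵒᵖ U] : H ⊗[k] U →ₗ[k] H ⊗[k] Induced k g U :=
  ((inducedRel (k := k) g U).mkQ.restrictScalars k).lTensor H ∘ₗ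
    (TensorProduct.assoc k H H U).toLinearMap ∘ₗ
    (((adAction k).toLinearMap.flip g).rTensor H ∘ₗ comul).rTensor U

theorem preInducedCoaction_tmul (g : H) (U : Type*) [AddCommGroup U] [Module k U]
    [Module (NLine k g)ᵐᵒᵖ U] (h : H) (u : U) :
    preInducedCoaction g U (h ⊗ₜ u) =
      (((inducedRel (k := k) g U).mkQ.restrictScalars k) ∘ₗ
        (TensorProduct.mk k H U).flip u).lTensor H
          (((adAction k).toLinearMap.flip g).rTensor H (comul h)) := by
  simp only [preInducedCoaction, LinearMap.comp_apply, LinearMap.rTensor_tmul]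
  generalize ((adAction k).toLinearMap.flip g).rTensor H (comul (R := k) h) = d
  induction d with
  | zero => simp
  | add a b ha hb => simp only [TensorProduct.add_tmul, map_add] at *; rw [ha, hb]
  | tmul a b => rfl

theorem preInducedCoaction_smul (g : H) (U : Type*) [AddCommGroup U] [Module k U]
    [Module (NLine k g)ᵐᵒᵖ U] (h : H) (z : H ⊗[k] U) :
    preInducedCoaction g U (h • z) =
      diagAction k (Induced k g U) h (preInducedCoaction g U z) := by
  have h0 : ∀ (a : H) (u : U), preInducedCoaction g U (a ⊗ₜ u) =
      diagAction k (Induced k g U) a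
        (g ⊗ₜ (inducedRel (k := k) g U).mkQ ((1 : H) ⊗ₜ[k] u)) := fun a u => by
    rw [preInducedCoaction_tmul, ← LinearMap.lTensor_id_apply H H
      (((adAction k).toLinearMap.flip g).rTensor H (comul a)), ← LinearMap.mulRight_one (R := k),
      ← diagAction_tmul_mul, diagAction_lTensor]
    · simp
    · intro b x
      rw [LinearMap.comp_apply, LinearMap.comp_apply, LinearMap.flip_apply, LinearMap.flip_apply,
        TensorProduct.mk_apply, TensorProduct.mk_apply, smul_eq_mul, ← smul_eq_mul b x,
        ← TensorProduct.smul_tmul', LinearMap.restrictScalars_apply,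
        LinearMap.restrictScalars_apply, map_smul]
  induction z with
  | zero => simp
  | add p q hp hq => rw [smul_add, map_add, map_add, map_add, hp, hq]
  | tmul a u => rw [TensorProduct.smul_tmul', h0, h0, smul_eq_mul, map_mul, Module.End.mul_apply]

theorem inducedRel_le_ker (g : H) (U : Type*) [AddCommGroup U] [Module k U]
    [Module (NLine k g)ᵐᵒᵖ U] :
    (inducedRel (k := k) g U).restrictScalars k ≤ LinearMap.ker (preInducedCoaction g U) := by
  intro z hz
  rw [LinearMap.mem_ker]
  rw [Submodule.restrictScalars_mem] at hz
  refine Submodule.span_induction (p := fun z _ => preInducedCoaction g U z = 0)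
    ?_ (map_zero _) (fun a b _ _ ha hb => by rw [map_add, ha, hb, add_zero])
    (fun h a _ ha => by rw [preInducedCoaction_smul, ha, map_zero]) hz
  rintro z ⟨h, x, u, rfl⟩
  have hx := contract_mem_adStabilizer g x
  have h1 := (adStabilizer k g).one_mem
  change ((adAction k).toLinearMap.flip g).rTensor H (comul _) = _ at hx h1
  have e : h ⊗ₜ[k] (MulOpposite.op x • u) -
      (h * DualHW.contract (x : DualHW k H (k ∙ g))) ⊗ₜ[k] u =
      h • ((1 : H) ⊗ₜ[k] (MulOpposite.op x • u) -
        DualHW.contract (x : DualHW k H (k ∙ g)) ⊗ₜ[k] u) := by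
    rw [smul_sub, TensorProduct.smul_tmul', TensorProduct.smul_tmul', smul_eq_mul, smul_eq_mul,
      mul_one]
  rw [e, preInducedCoaction_smul, map_sub, preInducedCoaction_tmul, preInducedCoaction_tmul, hx, h1,
    LinearMap.lTensor_tmul, LinearMap.lTensor_tmul, ← TensorProduct.tmul_sub]
  have hz0 : (((inducedRel (k := k) g U).mkQ.restrictScalars k) ∘ₗ
        (TensorProduct.mk k H U).flip (MulOpposite.op x • u)) 1 -
      (((inducedRel (k := k) g U).mkQ.restrictScalars k) ∘ₗ
        (TensorProduct.mk k H U).flip u) (DualHW.contract (x : DualHW k H (k ∙ g))) = 0 := by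
    rw [sub_eq_zero]
    refine (Submodule.Quotient.eq _).2 (Submodule.subset_span ⟨1, x, u, ?_⟩)
    simp
  rw [hz0, TensorProduct.tmul_zero, map_zero]

variable (k) in
/-- The coaction on `U ⊗_{N_W} H`, given by `u ⊗ h ↦ ∑ (h₁ ·_ad g) ⊗ (u ⊗ h₂)`. -/
def inducedCoaction (g : H) (U : Type*) [AddCommGroup U] [Module k U]
    [Module (NLine k g)ᵐᵒᵖ U] : Induced k g U →ₗ[k] H ⊗[k] Induced k g U :=
  ((inducedRel (k := k) g U).restrictScalars k).liftQ (preInducedCoaction g U)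
      (inducedRel_le_ker g U) ∘ₗ
    (Submodule.Quotient.restrictScalarsEquiv k (inducedRel (k := k) g U)).symm.toLinearMap

theorem inducedCoaction_mk (g : H) (U : Type*) [AddCommGroup U] [Module k U]
    [Module (NLine k g)ᵐᵒᵖ U] (z : H ⊗[k] U) :
    inducedCoaction k g U (Submodule.Quotient.mk z) = preInducedCoaction g U z := rfl

end Line

end RelYD
end

/-! For an object V let V_g = {v : ρ(v) = g ⊗ v} be its coinvariants, and let B be the stabilizer of
g. Since N_W is opposite to B, a right N_W-module U is a left B-module and the induced object is H
⊗_B U. With the coaction h ↦ ∑ (h₁ · g) ⊗ h₂, the coinvariants of H itself are B. The proof compares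
V with V_g.

First, Δ_R is equivariant for the adjoint action, so Δ_R(h · g) = ∑ (h₁ · g) ⊗ (h₂ · g). Thus H · g
is an adjoint-stable subcoalgebra inside D, and minimality gives D = H · g
(`IsMinimalAdjointStable.eq_range`).

The heart is a functional θ on H with θ(g) = 1 and (θ ⊗ id)Δ_R(d) = θ(d) g for d in D. Then E_V(v) =
∑ θ(v⁻¹) v⁰ projects V onto V_g, and E_V(h v) = E_H(h) v when v is coinvariant
(`IsObject.apply_coinvProj`, `coinvProj_smul`). Applied to an induced object, this shows that u ↦ 1
⊗ u is a bijection from U onto the coinvariants (`exists_inducedGen_eq`, `inducedGen_injective`).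
Moreover every subobject is generated over H by its coinvariants (`mem_span_coinvariants`). So a
nonzero subobject of H ⊗_B U meets 1 ⊗ U in a nonzero B-submodule, and a nonzero B-submodule of V_g
generates a nonzero subobject of V. Irreducibility therefore passes both ways, and H ⊗_B V_g → V is
an isomorphism when V is irreducible.

The functional is θ(b) = l(g S_R(b)), where S_R(b) = R² S(R¹ · b) is the braided antipode and l is a
normalized two-sided integral in the dual. Cosemisimplicity gives l and semisimplicity gives a
normalized two-sided integral L in H. Since l(L) ≠ 0, one gets l(S(x) y) = l(x S(y)), hence l is
invariant under the adjoint action (`exists_adInvariant_integral`). The braided antipode axiom makes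
g invertible with inverse S_R(g). Computing Δ(g) Δ(h · g⁻¹) through R and applying l to one leg
yields the identity for θ (`lineIntegral_adAction`). The antipode axiom also recovers v as ∑ l(v⁻²
S_R(v⁻¹)) v⁰, and invariance of l turns this into a sum of elements h E_V(h' v), which is the
generation statement.

Most Sweedler computations take place in convolution algebras Hom(H, A), where an algebra map f has
inverse f ∘ S and a ∈ A is embedded as h ↦ ε(h) a. Identities then follow by cancelling inverses. -/

noncomputable section

namespace RelYD

open TensorProduct WithConv HopfAlgebra

/-! ### Tensors over a field -/

section Tensors

variable {k M N : Type*} [Field k] [AddCommGroup M] [Module k M] [AddCommGroup N] [Module k N]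

/-- The functionals on the right factor separate the elements of a tensor product. -/
theorem tensor_eq_zero_of_forall_right {t : M ⊗[k] N}
    (h : ∀ f : Module.Dual k N, TensorProduct.rid k M (f.lTensor M t) = 0) : t = 0 := by
  classical
  have b := Module.Basis.ofVectorSpace k N
  apply (TensorProduct.equivFinsuppOfBasisRight (M := M) b).injective
  ext i
  rw [map_zero, Finsupp.zero_apply, ← h (b.coord i)]
  generalize t = s
  induction s with
  | zero => simp
  | add x y hx hy => simp only [map_add, Finsupp.add_apply, hx, hy]
  | tmul x y => simp

/-- The functionals on the left factor separate the elements of a tensor product. -/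
theorem tensor_eq_zero_of_forall_left {t : M ⊗[k] N}
    (h : ∀ f : Module.Dual k M, TensorProduct.lid k N (f.rTensor N t) = 0) : t = 0 := by
  apply (TensorProduct.comm k M N).injective
  rw [map_zero]
  refine tensor_eq_zero_of_forall_right fun f => ?_
  rw [← h f]
  generalize t = s
  induction s with
  | zero => simp
  | add x y hx hy => simp only [map_add, hx, hy]
  | tmul x y => simp

/-- A projection onto a subspace. -/
theorem exists_projection (C : Submodule k M) :
    ∃ q : M →ₗ[k] C, ∀ c : C, q c = c := by
  obtain ⟨q, hq⟩ := C.subtype.exists_leftInverse_of_injective C.ker_subtype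
  exact ⟨q, fun c => LinearMap.congr_fun hq c⟩

end Tensors

/-! ### Integrals -/

section Integrals

variable {k H : Type*} [Field k] [Ring H] [HopfAlgebra k H]

/-- Over a field, containment of Δ(c) in C ⊗ C can be tested on slices. Subcoalgebras thereby become
submodules for the two actions of the dual algebra, to which the theory of semisimple modules
applies. -/
theorem isSubcoalgebra_comul_iff (C : Submodule k H) :
    IsSubcoalgebra comul C ↔ ∀ f : Module.Dual k H, ∀ c ∈ C,
      TensorProduct.rid k H (f.lTensor H (comul c)) ∈ C ∧
      TensorProduct.lid k H (f.rTensor H (comul c)) ∈ C := by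
  constructor
  · intro h f c hc
    obtain ⟨t, ht⟩ := h c hc
    rw [← ht]
    clear ht
    induction t with
    | zero => simp
    | add x y hx hy =>
      simp only [map_add]
      exact ⟨C.add_mem hx.1 hy.1, C.add_mem hx.2 hy.2⟩
    | tmul x y =>
      simp only [map_tmul, LinearMap.lTensor_tmul, LinearMap.rTensor_tmul, rid_tmul, lid_tmul]
      exact ⟨C.smul_mem _ x.2, C.smul_mem _ y.2⟩
  · intro h c hc
    obtain ⟨q, hq⟩ := exists_projection C
    -- Slicing the second leg leaves an element of C, which the projection q fixes; hence q may be
    -- inserted in the first leg of Δ(c), and symmetrically in the second.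
    have h1 : (C.subtype ∘ₗ q).rTensor H (comul c) = comul (R := k) c := by
      rw [← sub_eq_zero]
      refine tensor_eq_zero_of_forall_right fun f => ?_
      have key : ∀ t : H ⊗[k] H, TensorProduct.rid k H (f.lTensor H
          ((C.subtype ∘ₗ q).rTensor H t)) = q (TensorProduct.rid k H (f.lTensor H t)) := by
        intro t
        induction t with
        | zero => simp
        | add x y hx hy => simp only [map_add, hx, hy, Submodule.coe_add]
        | tmul x y => simp
      rw [map_sub, map_sub, key, sub_eq_zero]
      exact congrArg Subtype.val (hq ⟨_, (h f c hc).1⟩)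
    have h2 : (C.subtype ∘ₗ q).lTensor H (comul c) = comul (R := k) c := by
      rw [← sub_eq_zero]
      refine tensor_eq_zero_of_forall_left fun f => ?_
      have key : ∀ t : H ⊗[k] H, TensorProduct.lid k H (f.rTensor H
          ((C.subtype ∘ₗ q).lTensor H t)) = q (TensorProduct.lid k H (f.rTensor H t)) := by
        intro t
        induction t with
        | zero => simp
        | add x y hx hy => simp only [map_add, hx, hy, Submodule.coe_add]
        | tmul x y => simp
      rw [map_sub, map_sub, key, sub_eq_zero]
      exact congrArg Subtype.val (hq ⟨_, (h f c hc).2⟩)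
    refine ⟨TensorProduct.map q q (comul c), ?_⟩
    rw [← LinearMap.comp_apply, ← TensorProduct.map_comp,
      ← LinearMap.rTensor_comp_lTensor, LinearMap.comp_apply, h2, h1]

variable (k H) in
/-- The subalgebra of `End(H)` generated by the left and the right action of the dual algebra. -/
def dualActionAlgebra : Subalgebra k (Module.End k H) :=
  Algebra.adjoin k (Set.range fun f : Module.Dual k H =>
      (TensorProduct.rid k H).toLinearMap ∘ₗ f.lTensor H ∘ₗ comul) ⊔
    Algebra.adjoin k (Set.range fun f : Module.Dual k H =>
      (TensorProduct.lid k H).toLinearMap ∘ₗ f.rTensor H ∘ₗ comul)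

theorem IsSubcoalgebra.apply_mem {C : Submodule k H} (h : IsSubcoalgebra comul C)
    (a : dualActionAlgebra k H) {c : H} (hc : c ∈ C) : a • c ∈ C := by
  let B : Subalgebra k (Module.End k H) :=
    { carrier := {a | ∀ c ∈ C, a c ∈ C}
      mul_mem' := fun ha hb c hc => ha _ (hb c hc)
      add_mem' := fun ha hb c hc => C.add_mem (ha c hc) (hb c hc)
      algebraMap_mem' := fun r c hc => by
        rw [Module.algebraMap_end_apply]; exact C.smul_mem r hc }
  have hB : dualActionAlgebra k H ≤ B := by
    refine sup_le (Algebra.adjoin_le ?_) (Algebra.adjoin_le ?_)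
    · rintro _ ⟨f, rfl⟩ c hc
      exact ((isSubcoalgebra_comul_iff C).1 h f c hc).1
    · rintro _ ⟨f, rfl⟩ c hc
      exact ((isSubcoalgebra_comul_iff C).1 h f c hc).2
  exact hB a.2 c hc

variable (k H) in
/-- The ring generated by the left and the right action of the dual algebra on `H`. -/
def DualActionRing : Type _ := dualActionAlgebra k H

instance : Ring (DualActionRing k H) := inferInstanceAs (Ring (dualActionAlgebra k H))

instance : Module (DualActionRing k H) H := inferInstanceAs (Module (dualActionAlgebra k H) H)

instance : Module k (DualActionRing k H) := inferInstanceAs (Module k (dualActionAlgebra k H))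

instance : IsScalarTower k (DualActionRing k H) H :=
  inferInstanceAs (IsScalarTower k (dualActionAlgebra k H) H)

/-- A subcoalgebra as a submodule for the two actions of the dual algebra. -/
def IsSubcoalgebra.toSubmodule {C : Submodule k H} (h : IsSubcoalgebra comul C) :
    Submodule (DualActionRing k H) H where
  __ := C.toAddSubmonoid
  smul_mem' a _ hc := h.apply_mem a hc

theorem isSubcoalgebra_restrictScalars (P : Submodule (DualActionRing k H) H) :
    IsSubcoalgebra comul (P.restrictScalars k) := by
  rw [isSubcoalgebra_comul_iff]
  intro f c hc
  constructor
  · exact P.smul_mem ⟨_, (le_sup_left : _ ≤ dualActionAlgebra k H)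
      (Algebra.subset_adjoin ⟨f, rfl⟩)⟩ hc
  · exact P.smul_mem ⟨_, (le_sup_right : _ ≤ dualActionAlgebra k H)
      (Algebra.subset_adjoin ⟨f, rfl⟩)⟩ hc

/-- Subcoalgebras are exactly the submodules for this ring, so a simple subcoalgebra is a simple
submodule and the sum of all of them is H. -/
theorem isSemisimpleModule_dualActionAlgebra (h : IsCosemisimple k H) :
    IsSemisimpleModule (DualActionRing k H) H := by
  apply IsSemisimpleModule.of_sSup_simples_eq_top
  rw [eq_top_iff]
  have key : (⊤ : Submodule k H) ≤ (sSup {m : Submodule (DualActionRing k H) H |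
      IsSimpleModule (DualActionRing k H) m}).restrictScalars k := by
    rw [← show sSup _ = (⊤ : Submodule k H) from h]
    refine sSup_le fun C hC => ?_
    have hs : IsSimpleModule (DualActionRing k H) hC.1.1.toSubmodule := by
      rw [isSimpleModule_iff_isAtom]
      constructor
      · intro h0
        refine hC.1.2 ((Submodule.eq_bot_iff _).2 fun x hx => ?_)
        have : x ∈ hC.1.1.toSubmodule := hx
        rwa [h0, Submodule.mem_bot] at this
      · intro P hP
        by_contra hP0
        refine hP.not_ge fun x hx => ?_
        refine hC.2 (y := P.restrictScalars k) ⟨isSubcoalgebra_restrictScalars P, ?_⟩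
          (fun y hy => hP.le hy) hx
        rwa [Ne, Submodule.restrictScalars_eq_bot_iff]
    intro x hx
    exact (le_sSup (show hC.1.1.toSubmodule ∈ {m : Submodule (DualActionRing k H) H |
      IsSimpleModule (DualActionRing k H) m} from hs) : _ ≤ _) hx
  exact fun x hx => key (Submodule.mem_top (x := x))

/-- A normalized two-sided integral in the dual of a cosemisimple Hopf algebra. -/
theorem exists_dual_integral (h : IsCosemisimple k H) :
    ∃ l : Module.Dual k H, l 1 = 1 ∧
      (∀ a, TensorProduct.rid k H (l.lTensor H (comul a)) = l a • 1) ∧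
      ∀ a, TensorProduct.lid k H (l.rTensor H (comul a)) = l a • 1 := by
  have := isSemisimpleModule_dualActionAlgebra h
  have h1 : IsSubcoalgebra (comul (R := k)) (Submodule.span k {(1 : H)}) := by
    rw [isSubcoalgebra_comul_iff]
    intro f c hc
    obtain ⟨r, rfl⟩ := Submodule.mem_span_singleton.1 hc
    rw [map_smul, Bialgebra.comul_one, Algebra.TensorProduct.one_def]
    simp only [map_smul, LinearMap.lTensor_tmul, LinearMap.rTensor_tmul, rid_tmul, lid_tmul]
    exact ⟨Submodule.smul_mem _ _ (Submodule.smul_mem _ _ (Submodule.mem_span_singleton_self _)),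
      Submodule.smul_mem _ _ (Submodule.smul_mem _ _ (Submodule.mem_span_singleton_self _))⟩
  -- The line k1 is a submodule, so it has a complement E that is again a subcoalgebra. The integral
  -- l is the coordinate of 1 along E; both integral identities hold because Δ(E) ⊆ E ⊗ E is killed
  -- by l on either leg.
  obtain ⟨E, hE⟩ := exists_isCompl h1.toSubmodule
  have hE1 : (1 : H) ∉ E := fun h0 => by
    have h3 := (Submodule.disjoint_def.1 hE.disjoint) 1 (Submodule.mem_span_singleton_self (1 : H)) h0
    have h4 := congrArg (counit (R := k)) h3
    simp at h4
  obtain ⟨l, hl1, hlE⟩ : ∃ l : Module.Dual k H, l 1 = 1 ∧ ∀ x ∈ E, l x = 0 := by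
    obtain ⟨f, hf, hfE⟩ := Submodule.exists_dual_map_eq_bot_of_notMem
      (p := E.restrictScalars k) (x := (1 : H)) hE1 inferInstance
    refine ⟨(f 1)⁻¹ • f, by simp [hf], fun x hx => ?_⟩
    have : f x ∈ (E.restrictScalars k).map f := ⟨x, hx, rfl⟩
    rw [hfE, Submodule.mem_bot] at this
    simp [this]
  have hdec : ∀ a : H, ∃ r : k, ∃ e ∈ E, a = r • 1 + e := fun a => by
    have ha : a ∈ h1.toSubmodule ⊔ E := by rw [hE.sup_eq_top]; trivial
    obtain ⟨y, hy, e, he, rfl⟩ := Submodule.mem_sup.1 ha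
    obtain ⟨r, rfl⟩ := Submodule.mem_span_singleton.1 (show y ∈ Submodule.span k {(1 : H)} from hy)
    exact ⟨r, e, he, rfl⟩
  have hEE : ∀ e ∈ E, l.lTensor H (comul e) = 0 ∧ l.rTensor H (comul e) = 0 := fun e he => by
    obtain ⟨t, ht⟩ := isSubcoalgebra_restrictScalars E e he
    rw [← ht]
    clear ht
    induction t with
    | zero => simp
    | add x y hx hy => simp [hx.1, hx.2, hy.1, hy.2]
    | tmul x y => simp [hlE _ x.2, hlE _ y.2]
  refine ⟨l, hl1, fun a => ?_, fun a => ?_⟩ <;>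
  · obtain ⟨r, e, he, rfl⟩ := hdec a
    simp [(hEE e he).1, (hEE e he).2, hlE e he, Algebra.TensorProduct.one_def, hl1]

/-- Take a left ideal J complementary to ker ε and let L be the J-component of 1. Then (ker ε) L
lies in J and in ker ε, so it vanishes. -/
theorem exists_left_integral_of_isSemisimpleRing {A : Type*} [Ring A] [IsSemisimpleRing A]
    (ε : A →+* k) : ∃ L : A, ε L = 1 ∧ ∀ a, ε a = 0 → a * L = 0 := by
  obtain ⟨J, hJ⟩ := exists_isCompl (RingHom.ker ε)
  have h1 : (1 : A) ∈ RingHom.ker ε ⊔ J := by rw [hJ.sup_eq_top]; trivial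
  obtain ⟨a, ha, b, hb, hab⟩ := Submodule.mem_sup.1 h1
  refine ⟨b, ?_, fun x hx => ?_⟩
  · have := congrArg ε hab
    rwa [map_add, (RingHom.mem_ker).1 ha, zero_add, map_one] at this
  · refine (Submodule.disjoint_def.1 hJ.disjoint) _ ?_ (J.smul_mem x hb)
    rw [RingHom.mem_ker, map_mul, hx, zero_mul]

/-- A normalized two-sided integral in a semisimple Hopf algebra. -/
theorem exists_integral [IsSemisimpleRing H] :
    ∃ L : H, counit (R := k) L = 1 ∧ (∀ h : H, h * L = counit (R := k) h • L) ∧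
      ∀ h : H, L * h = counit (R := k) h • L := by
  let ε : H →+* k := (Bialgebra.counitAlgHom k H).toRingHom
  have hε : ∀ h, ε h = counit (R := k) h := fun h => rfl
  obtain ⟨L, hL1, hL⟩ := exists_left_integral_of_isSemisimpleRing ε
  obtain ⟨L', hL1', hL'⟩ := exists_left_integral_of_isSemisimpleRing
    (A := Hᵐᵒᵖ) (ε.fromOpposite fun x y => Commute.all _ _)
  have h1 : ∀ h : H, h * L = counit (R := k) h • L := fun h => by
    have := hL (h - counit (R := k) h • 1) (by rw [hε, map_sub, map_smul]; simp)
    rwa [sub_mul, sub_eq_zero, smul_mul_assoc, one_mul] at this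
  have h2 : ∀ h : H, L'.unop * h = counit (R := k) h • L'.unop := fun h => by
    have := congrArg MulOpposite.unop (hL' (MulOpposite.op (h - counit (R := k) h • 1)) (by
      change ε _ = 0
      rw [MulOpposite.unop_op, hε, map_sub, map_smul]; simp))
    simp only [MulOpposite.unop_mul, MulOpposite.unop_op, MulOpposite.unop_zero] at this
    rwa [mul_sub, sub_eq_zero, mul_smul_comm, mul_one] at this
  -- Evaluating the product L' L once with the left integral and once with the right one gives L =
  -- L'.
  have h3 : L'.unop = L := by
    have a := h1 L'.unop
    have b := h2 L
    rw [show counit (R := k) L'.unop = 1 from hL1', one_smul] at a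
    rw [← hε, hL1, one_smul] at b
    exact b.symm.trans a
  rw [h3] at h2
  exact ⟨L, hL1, h1, h2⟩

end Integrals

/-! ### Constants in the convolution algebra -/

section Convolution

variable {k H A : Type*} [Field k] [Ring H] [HopfAlgebra k H] [Ring A] [Algebra k A]

variable (k H) in
/-- The map `h ↦ ε(h) a`, as an element of the convolution algebra `Hom(H, A)`. -/
def convConst (a : A) : WithConv (H →ₗ[k] A) :=
  toConv (LinearMap.toSpanSingleton k A a ∘ₗ counit)

@[simp]
theorem convConst_apply (a : A) (h : H) : convConst k H a h = counit (R := k) h • a := rfl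

@[simp]
theorem convConst_one : convConst k H (1 : A) = 1 := by
  ext h
  simp [Algebra.algebraMap_eq_smul_one]

theorem convConst_mul_apply (a : A) (f : WithConv (H →ₗ[k] A)) (h : H) :
    (convConst k H a * f) h = a * f h := by
  have h1 : ∀ t : H ⊗[k] H, LinearMap.mul' k A (TensorProduct.map (convConst k H a).ofConv f.ofConv t)
      = a * f.ofConv (TensorProduct.lid k H ((counit (R := k)).rTensor H t)) := fun t => by
    induction t with
    | zero => simp
    | add x y hx hy => simp only [map_add, mul_add, hx, hy]
    | tmul x y =>
      change (counit (R := k) x • a) * f.ofConv y = _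
      simp
  rw [LinearMap.convMul_apply, h1, Coalgebra.rTensor_counit_comul]
  simp

theorem mul_convConst_apply (a : A) (f : WithConv (H →ₗ[k] A)) (h : H) :
    (f * convConst k H a) h = f h * a := by
  have h1 : ∀ t : H ⊗[k] H, LinearMap.mul' k A (TensorProduct.map f.ofConv (convConst k H a).ofConv t)
      = f.ofConv (TensorProduct.rid k H ((counit (R := k)).lTensor H t)) * a := fun t => by
    induction t with
    | zero => simp
    | add x y hx hy => simp only [map_add, add_mul, hx, hy]
    | tmul x y =>
      change f.ofConv x * (counit (R := k) y • a) = _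
      simp
  rw [LinearMap.convMul_apply, h1, Coalgebra.lTensor_counit_comul]
  simp

theorem convConst_mul_convConst (a b : A) :
    convConst k H a * convConst k H b = convConst k H (a * b) := by
  ext h
  change (convConst k H a * convConst k H b) h = _
  rw [convConst_mul_apply]
  simp

/-- An algebra map `H → A` as an element of the convolution algebra. -/
def convHom (f : H →ₐ[k] A) : WithConv (H →ₗ[k] A) := toConv f.toLinearMap

/-- The composition of an algebra map `H → A` with the antipode. -/
def convInvHom (f : H →ₐ[k] A) : WithConv (H →ₗ[k] A) := toConv (f.toLinearMap ∘ₗ antipode k)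

@[simp]
theorem convHom_apply (f : H →ₐ[k] A) (h : H) : convHom f h = f h := rfl

@[simp]
theorem convInvHom_apply (f : H →ₐ[k] A) (h : H) : convInvHom f h = f (antipode k h) := rfl

-- Composition with an algebra map is multiplicative for convolution, so this is the image of id * S
-- = 1.
@[simp]
theorem convHom_mul_convInvHom (f : H →ₐ[k] A) : convHom f * convInvHom f = 1 := by
  apply WithConv.ext
  have := LinearMap.algHom_comp_convMul_distrib f (toConv LinearMap.id) (toConv (antipode k (A := H)))
  rw [LinearMap.id_mul_antipode] at this
  refine this.symm.trans ?_
  ext h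
  simp [LinearMap.convOne_def]

@[simp]
theorem convInvHom_mul_convHom (f : H →ₐ[k] A) : convInvHom f * convHom f = 1 := by
  apply WithConv.ext
  have := LinearMap.algHom_comp_convMul_distrib f (toConv (antipode k (A := H))) (toConv LinearMap.id)
  rw [LinearMap.antipode_mul_id] at this
  refine this.symm.trans ?_
  ext h
  simp [LinearMap.convOne_def]

variable (k H) in
/-- The algebra map `h ↦ h ⊗ 1`. -/
abbrev inl : H →ₐ[k] H ⊗[k] H := Algebra.TensorProduct.includeLeft

variable (k H) in
/-- The algebra map `h ↦ 1 ⊗ h`. -/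
abbrev inr : H →ₐ[k] H ⊗[k] H := Algebra.TensorProduct.includeRight

theorem convHom_comul : convHom (Bialgebra.comulAlgHom k H) = convHom (inl k H) * convHom (inr k H) := by
  ext h
  change comul h = _
  rw [LinearMap.convMul_apply]
  generalize comul (R := k) h = d
  induction d with
  | zero => simp
  | add x y hx hy => rw [map_add, map_add, ← hx, ← hy]
  | tmul x y => simp [convHom]

/-- The antipode is an anti-coalgebra map. -/
theorem convInvHom_comul : convInvHom (Bialgebra.comulAlgHom k H) =
    convInvHom (inr k H) * convInvHom (inl k H) := by
  -- Δ is the convolution product of the two inclusions; both sides are its convolution inverse, the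
  -- right one in reversed order.
  refine left_inv_eq_right_inv (a := convHom (Bialgebra.comulAlgHom k H))
    (convInvHom_mul_convHom _) ?_
  rw [convHom_comul, mul_assoc, ← mul_assoc (convHom (inr k H)), convHom_mul_convInvHom, one_mul,
    convHom_mul_convInvHom]

theorem comul_antipode (h : H) : comul (R := k) (antipode k h) =
    TensorProduct.map (antipode k) (antipode k) (TensorProduct.comm k H H (comul h)) := by
  have := congrArg (fun f => f h) (convInvHom_comul (k := k) (H := H))
  refine this.trans ?_
  rw [LinearMap.convMul_apply]
  generalize comul (R := k) h = d
  induction d with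
  | zero => simp
  | add x y hx hy => simp only [map_add, hx, hy]
  | tmul x y => simp [convInvHom]

end Convolution

/-! ### Integrals and the adjoint action -/

section Integrals

variable {k H : Type*} [Field k] [Ring H] [HopfAlgebra k H]

/-- Since Δ(L) Δ(h) = ε(h) Δ(L), convolving the constant Δ(L) with Δ = `inl` * `inr` changes
nothing; cancelling `inr` on the right leaves the claim. -/
theorem comul_integral_mul {L : H} (hL : ∀ h : H, L * h = counit (R := k) h • L) (y : H) :
    comul L * (y ⊗ₜ[k] (1 : H)) = comul L * ((1 : H) ⊗ₜ antipode k y) := by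
  have h1 : convConst k H (comul (R := k) L) * convHom (Bialgebra.comulAlgHom k H) =
      convConst k H (comul (R := k) L) := by
    ext h
    change (convConst k H (comul (R := k) L) * convHom (Bialgebra.comulAlgHom k H)) h = _
    rw [convConst_mul_apply]
    simp [← Bialgebra.comul_mul, hL]
  have h2 : convConst k H (comul (R := k) L) * convHom (inl k H) =
      convConst k H (comul (R := k) L) * convInvHom (inr k H) := by
    conv_rhs => rw [← h1, convHom_comul]
    simp only [mul_assoc, convHom_mul_convInvHom, mul_one]
  have h3 := congrArg (fun f => f y) h2
  change (convConst k H (comul (R := k) L) * convHom (inl k H)) y =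
    (convConst k H (comul (R := k) L) * convInvHom (inr k H)) y at h3
  rw [convConst_mul_apply, convConst_mul_apply] at h3
  simpa using h3

theorem mul_comul_integral {L : H} (hL : ∀ h : H, h * L = counit (R := k) h • L) (y : H) :
    ((1 : H) ⊗ₜ[k] y) * comul L = (antipode k y ⊗ₜ[k] (1 : H)) * comul L := by
  have h1 : convHom (Bialgebra.comulAlgHom k H) * convConst k H (comul (R := k) L) =
      convConst k H (comul (R := k) L) := by
    ext h
    change (convHom (Bialgebra.comulAlgHom k H) * convConst k H (comul (R := k) L)) h = _
    rw [mul_convConst_apply]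
    simp [← Bialgebra.comul_mul, hL]
  have h2 : convHom (inr k H) * convConst k H (comul (R := k) L) =
      convInvHom (inl k H) * convConst k H (comul (R := k) L) := by
    conv_rhs => rw [← h1, convHom_comul]
    simp only [← mul_assoc, convInvHom_mul_convHom, one_mul]
  have h3 := congrArg (fun f => f y) h2
  change (convHom (inr k H) * convConst k H (comul (R := k) L)) y =
    (convInvHom (inl k H) * convConst k H (comul (R := k) L)) y at h3
  rw [mul_convConst_apply, mul_convConst_apply] at h3
  simpa using h3

/-- A normalized integral pairs nontrivially with a normalized integral in the dual. -/
theorem dual_integral_apply_integral_ne_zero {l : Module.Dual k H} {L : H} (hl1 : l 1 = 1)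
    (hl : ∀ a, TensorProduct.lid k H (l.rTensor H (comul a)) = l a • 1)
    (hL1 : counit (R := k) L = 1) (hL : ∀ h : H, L * h = counit (R := k) h • L) : l L ≠ 0 := by
  classical
  intro h0
  -- If l(L) = 0, moving y to the second leg as S(y) shows ∑ l(L₁ y) L₂ = l(L) S(y) = 0.
  have h1 : ∀ y : H, TensorProduct.lid k H (l.rTensor H (comul L * (y ⊗ₜ[k] (1 : H)))) = 0 := by
    intro y
    rw [comul_integral_mul hL]
    have : ∀ t : H ⊗[k] H, TensorProduct.lid k H (l.rTensor H (t * ((1 : H) ⊗ₜ antipode k y))) =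
        TensorProduct.lid k H (l.rTensor H t) * antipode k y := fun t => by
      induction t with
      | zero => simp
      | add x y hx hy => simp only [map_add, add_mul, hx, hy]
      | tmul x y => simp
    rw [this, hl, h0]
    simp
  have b := Module.Basis.ofVectorSpace k H
  -- Expanding the second leg in a basis bᵢ with coefficients cᵢ, linear independence gives l(cᵢ y)
  -- = 0 for every y. The choice y = S(bᵢ) then gives l(L₁ S(L₂)) = 0, whereas this equals ε(L) l(1)
  -- = 1.
  have h2 : ∀ t : H ⊗[k] H,
      (∀ y : H, TensorProduct.lid k H (l.rTensor H (t * (y ⊗ₜ[k] (1 : H)))) = 0) →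
      l (LinearMap.mul' k H ((antipode k).lTensor H t)) = 0 := by
    intro t ht
    obtain ⟨c, rfl⟩ := (TensorProduct.equivFinsuppOfBasisRight (M := H) b).symm.surjective t
    have hc : (TensorProduct.equivFinsuppOfBasisRight (M := H) b).symm c =
        c.sum fun i m => m ⊗ₜ[k] b i := by
      rw [← LinearEquiv.coe_toLinearMap, TensorProduct.equivFinsuppOfBasisRight_symm]
      simp [Finsupp.sum]
    rw [hc] at ht ⊢
    have h3 : ∀ (i) (y : H), l (c i * y) = 0 := by
      intro i y
      have := ht y
      simp only [Finsupp.sum, Finset.sum_mul, Algebra.TensorProduct.tmul_mul_tmul, mul_one, map_sum,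
        LinearMap.rTensor_tmul, lid_tmul] at this
      by_cases hi : i ∈ c.support
      · exact (linearIndependent_iff'.1 b.linearIndependent) _ _ this i hi
      · rw [Finsupp.notMem_support_iff.1 hi, zero_mul, map_zero]
    simp [Finsupp.sum, h3]
  have h4 := h2 _ h1
  rw [mul_antipode_lTensor_comul_apply, hL1, map_one, hl1] at h4
  exact one_ne_zero h4

/-- Apply l ⊗ l to (1 ⊗ x) Δ(L) (1 ⊗ S(y)) = (S(x) ⊗ 1) Δ(L) (y ⊗ 1). As l is an integral on both
sides, the two expressions give l(x S(y)) l(L) and l(S(x) y) l(L), and l(L) can be cancelled. -/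
theorem dual_integral_antipode_mul {l : Module.Dual k H} {L : H} (h0 : l L ≠ 0)
    (hl : ∀ a, TensorProduct.lid k H (l.rTensor H (comul a)) = l a • 1)
    (hl' : ∀ a, TensorProduct.rid k H (l.lTensor H (comul a)) = l a • 1)
    (hL : ∀ h : H, L * h = counit (R := k) h • L)
    (hL' : ∀ h : H, h * L = counit (R := k) h • L) (x y : H) :
    l (antipode k x * y) = l (x * antipode k y) := by
  let P : H ⊗[k] H →ₗ[k] k := TensorProduct.lift ((LinearMap.mul k k).compl₁₂ l l)
  have hP : ∀ a b, P (a ⊗ₜ b) = l a * l b := fun a b => rfl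
  have h1 : P (((1 : H) ⊗ₜ[k] x) * (comul L * ((1 : H) ⊗ₜ antipode k y))) =
      l (x * antipode k y) * l L := by
    have : ∀ t : H ⊗[k] H, P (((1 : H) ⊗ₜ[k] x) * (t * ((1 : H) ⊗ₜ antipode k y))) =
        l (x * TensorProduct.lid k H (l.rTensor H t) * antipode k y) := fun t => by
      induction t with
      | zero => simp
      | add x y hx hy => simp only [map_add, add_mul, mul_add, hx, hy]
      | tmul a b => simp [hP, mul_assoc]
    rw [this, hl]
    simp [mul_comm]
  have h2 : P ((antipode k x ⊗ₜ[k] (1 : H)) * comul L * (y ⊗ₜ[k] (1 : H))) =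
      l (antipode k x * y) * l L := by
    have : ∀ t : H ⊗[k] H, P ((antipode k x ⊗ₜ[k] (1 : H)) * t * (y ⊗ₜ[k] (1 : H))) =
        l (antipode k x * TensorProduct.rid k H (l.lTensor H t) * y) := fun t => by
      induction t with
      | zero => simp
      | add x y hx hy => simp only [map_add, add_mul, mul_add, hx, hy]
      | tmul a b => simp [hP, mul_comm]
    rw [this, hl']
    simp [mul_comm]
  rw [← comul_integral_mul hL, ← mul_assoc, mul_comul_integral hL', h2] at h1
  exact mul_right_cancel₀ h0 h1

/-- The adjoint action on pure tensors of the comultiplication. -/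
theorem adAction_apply (h a : H) : adAction k h a =
    LinearMap.mul' k H (((LinearMap.mulRight k a)).rTensor H ((antipode k).lTensor H (comul h))) := by
  simp only [adAction, AlgHom.comp_apply, Bialgebra.comulAlgHom_apply]
  generalize comul (R := k) h = d
  induction d with
  | zero => simp
  | add x y hx hy => simp only [map_add, LinearMap.add_apply, hx, hy]
  | tmul x y => simp

variable (k H) in
/-- A normalized two-sided integral in the dual is invariant under the adjoint action. -/
theorem exists_adInvariant_integral [IsSemisimpleRing H] (h : IsCosemisimple k H) :
    ∃ l : Module.Dual k H, l 1 = 1 ∧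
      (∀ a, TensorProduct.rid k H (l.lTensor H (comul a)) = l a • 1) ∧
      ∀ h a : H, l (adAction k h a) = counit (R := k) h * l a := by
  obtain ⟨l, hl1, hl', hl⟩ := exists_dual_integral h
  obtain ⟨L, hL1, hL', hL⟩ := exists_integral (k := k) (H := H)
  have key := dual_integral_antipode_mul
    (dual_integral_apply_integral_ne_zero hl1 hl hL1 hL) hl hl' hL hL'
  have hS : ∀ y, l (antipode k y) = l y := fun y => by
    simpa using (key 1 y).symm
  refine ⟨l, hl1, hl', fun h a => ?_⟩
  -- Here l(x a S(y)) = l(S(x a) y) = l(S(a) S(x) y), so that S(h₁) h₂ = ε(h) appears after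
  -- substituting Δ(h).
  have : ∀ t : H ⊗[k] H, l (LinearMap.mul' k H
      ((LinearMap.mulRight k a).rTensor H ((antipode k).lTensor H t))) =
      l (antipode k a * LinearMap.mul' k H ((antipode k).rTensor H t)) := fun t => by
    induction t with
    | zero => simp
    | add x y hx hy => simp only [map_add, mul_add, hx, hy]
    | tmul x y =>
      simp only [LinearMap.lTensor_tmul, LinearMap.rTensor_tmul, LinearMap.mul'_apply,
        LinearMap.mulRight_apply]
      rw [← key, antipode_mul_antidistrib, mul_assoc]
  rw [adAction_apply, this, mul_antipode_rTensor_comul_apply, Algebra.algebraMap_eq_smul_one,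
    mul_smul_comm, mul_one, map_smul, hS, smul_eq_mul]

end Integrals

/-! ### The adjoint action -/

section Adjoint

variable {k H : Type*} [Field k] [Ring H] [HopfAlgebra k H]

variable (k) in
/-- The map `h ↦ h ·_ad x`, as an element of the convolution algebra. -/
def adOn (x : H) : WithConv (H →ₗ[k] H) := toConv ((adAction k).toLinearMap.flip x)

@[simp]
theorem adOn_apply (x h : H) : adOn k x h = adAction k h x := rfl

/-- With this form the adjoint action is conjugation by the identity map in the convolution algebra;
its multiplicativity in x becomes the cancellation S * id = 1. -/
theorem adOn_eq (x : H) : adOn k x =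
    convHom (AlgHom.id k H) * convConst k H x * convInvHom (AlgHom.id k H) := by
  ext h
  change adAction k h x = (convHom (AlgHom.id k H) * convConst k H x * convInvHom (AlgHom.id k H)) h
  have h1 : convHom (AlgHom.id k H) * convConst k H x =
      toConv (LinearMap.mulRight k x) := by
    ext h
    exact mul_convConst_apply x _ h
  rw [h1, LinearMap.convMul_apply, adAction_apply]
  generalize comul (R := k) h = d
  induction d with
  | zero => simp
  | add x y hx hy => simp only [map_add, hx, hy]
  | tmul x y => simp [convInvHom]

theorem adOn_mul (x y : H) : adOn k x * adOn k y = adOn k (x * y) := by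
  rw [adOn_eq, adOn_eq, adOn_eq, ← convConst_mul_convConst]
  simp only [mul_assoc]
  rw [← mul_assoc (convInvHom _) (convHom _), convInvHom_mul_convHom, one_mul]

@[simp]
theorem adOn_one : adOn k (1 : H) = 1 := by
  rw [adOn_eq, convConst_one, mul_one, convHom_mul_convInvHom]

theorem adOn_mul_id (x : H) : adOn k x * convHom (AlgHom.id k H) =
    convHom (AlgHom.id k H) * convConst k H x := by
  rw [adOn_eq, mul_assoc, convInvHom_mul_convHom, mul_one]

@[simp]
theorem adAction_one (h : H) : adAction k h (1 : H) = counit (R := k) h • 1 := by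
  rw [← adOn_apply, adOn_one, LinearMap.convOne_apply, Algebra.algebraMap_eq_smul_one]

/-- The adjoint action makes `H` a module algebra. -/
theorem adAction_mul (h x y : H) : adAction k h (x * y) =
    LinearMap.mul' k H (TensorProduct.map ((adAction k).toLinearMap.flip x)
      ((adAction k).toLinearMap.flip y) (comul h)) := by
  rw [← adOn_apply, ← adOn_mul]
  rfl

@[simp]
theorem counit_adAction (h x : H) :
    counit (R := k) (adAction k h x) = counit (R := k) h * counit (R := k) x := by
  have : ∀ t : H ⊗[k] H, counit (R := k) (LinearMap.mul' k H
      ((LinearMap.mulRight k x).rTensor H ((antipode k).lTensor H t))) =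
      counit (R := k) (TensorProduct.rid k H ((counit (R := k)).lTensor H t)) *
        counit (R := k) x := fun t => by
    induction t with
    | zero => simp
    | add x y hx hy => simp only [map_add, add_mul, hx, hy]
    | tmul a b => simp; ring
  rw [adAction_apply, this, Coalgebra.lTensor_counit_comul]
  simp

/-- An invariant functional satisfies `l((h · x) y) = l(x (S(h) · y))`. -/
theorem adInvariant_mul {l : Module.Dual k H}
    (hl : ∀ h a : H, l (adAction k h a) = counit (R := k) h * l a) (h x y : H) :
    l (adAction k h x * y) = l (x * adAction k (antipode k h) y) := by
  let F : WithConv (H →ₗ[k] H) := toConv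
    (LinearMap.mulLeft k x ∘ₗ (adAction k).toLinearMap.flip y ∘ₗ antipode k)
  let A : WithConv (H →ₗ[k] Module.End k H) := convHom (adAction k)
  let B : WithConv (H →ₗ[k] Module.End k H) :=
    convConst k H (LinearMap.mulLeft k x) * convInvHom (adAction k)
  let C : WithConv (H →ₗ[k] Module.End k H) :=
    toConv ((Algebra.lmul k H).toLinearMap ∘ₗ (adAction k).toLinearMap.flip x)
  -- This is the module algebra law as an identity of operators. Multiplying by the inverse of A
  -- gives (h · x) y = ∑ h₁ · (x (S(h₂) · y)), and l turns the outer action into ε(h₁).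
  have h1 : A * convConst k H (LinearMap.mulLeft k x) = C * A := by
    ext h z
    change (A * convConst k H (LinearMap.mulLeft k x)) h z = (C * A) h z
    rw [mul_convConst_apply, LinearMap.convMul_apply]
    change adAction k h (x * z) = _
    rw [adAction_mul]
    generalize comul (R := k) h = d
    induction d with
    | zero => simp
    | add x y hx hy => simp only [map_add, LinearMap.add_apply, hx, hy]
    | tmul a b => simp [C, A, convHom]
  have h2 : A * B = C := by
    rw [← mul_assoc, h1, mul_assoc, convHom_mul_convInvHom, mul_one]
  have h3 : adAction k h x * y = (A * B) h y := by rw [h2]; rfl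
  have h4 : ∀ t : H ⊗[k] H, l (LinearMap.mul' k _ (TensorProduct.map A.ofConv B.ofConv t) y) =
      l (B.ofConv (TensorProduct.lid k H ((counit (R := k)).rTensor H t)) y) := fun t => by
    induction t with
    | zero => simp
    | add x y hx hy => simp only [map_add, LinearMap.add_apply, hx, hy]
    | tmul a b => simp [A, convHom, hl]
  rw [h3, LinearMap.convMul_apply, h4, Coalgebra.rTensor_counit_comul]
  simp only [lid_tmul, one_smul]
  change l (B h y) = _
  rw [convConst_mul_apply]
  rfl

end Adjoint

/-! ### Quasi-triangular structures -/

section Quasitriangular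

variable {k H : Type*} [Field k] [Ring H] [HopfAlgebra k H] {R : H ⊗[k] H}

/-- `ε(R²) R¹ = 1`. -/
theorem IsQuasitriangular.counit_right (hR : IsQuasitriangular R) :
    TensorProduct.rid k H ((counit (R := k)).lTensor H R) = 1 := by
  -- F applies ε to the middle leg. The relation (id ⊗ Δ)(R) = R¹³ R¹² becomes R = R (R¹ ε(R²) ⊗ 1),
  -- and R is cancelled because it is invertible.
  let F : H ⊗[k] (H ⊗[k] H) →ₗ[k] H ⊗[k] H :=
    ((TensorProduct.lid k H).toLinearMap ∘ₗ (counit (R := k)).rTensor H).lTensor H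
  have h1 : F ((comul (R := k)).lTensor H R) = R := by
    rw [← LinearMap.comp_apply, ← LinearMap.lTensor_comp, LinearMap.comp_assoc,
      Coalgebra.rTensor_counit_comp_comul]
    convert LinearMap.lTensor_id_apply H H R
    ext; simp
  have h2 : ∀ s t : H ⊗[k] H, F ((TensorProduct.mk k H H 1).lTensor H s *
      TensorProduct.assoc k H H H ((TensorProduct.mk k (H ⊗[k] H) H).flip 1 t)) =
      s * (TensorProduct.rid k H ((counit (R := k)).lTensor H t) ⊗ₜ 1) := fun s t => by
    induction s with
    | zero => simp
    | add x y hx hy => simp only [map_add, add_mul, hx, hy]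
    | tmul a b =>
      induction t with
      | zero => simp
      | add x y hx hy => simp only [map_add, mul_add, add_tmul, hx, hy]
      | tmul c d => simp [F, TensorProduct.tmul_smul, TensorProduct.smul_tmul']
  have h3 := congrArg F hR.comul_right
  rw [h1, h2] at h3
  have h4 := hR.isUnit.mul_left_cancel ((mul_one R).trans h3)
  have h5 := congrArg (fun t => TensorProduct.rid k H ((counit (R := k)).lTensor H t)) h4
  simpa [Algebra.TensorProduct.one_def] using h5.symm

/-- `ε(R¹) R² = 1`. -/
theorem IsQuasitriangular.counit_left (hR : IsQuasitriangular R) :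
    TensorProduct.lid k H ((counit (R := k)).rTensor H R) = 1 := by
  let F : H ⊗[k] (H ⊗[k] H) →ₗ[k] H ⊗[k] H :=
    ((TensorProduct.lid k H).toLinearMap ∘ₗ (counit (R := k)).rTensor H).lTensor H
  have h1 : ∀ t : H ⊗[k] H, F (TensorProduct.assoc k H H H ((comul (R := k)).rTensor H t)) = t :=
    fun t => by
    induction t with
    | zero => simp
    | add x y hx hy => simp only [map_add, hx, hy]
    | tmul a b =>
      have : ∀ d : H ⊗[k] H, F (TensorProduct.assoc k H H H (d ⊗ₜ b)) =
          TensorProduct.rid k H ((counit (R := k)).lTensor H d) ⊗ₜ b := fun d => by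
        induction d with
        | zero => simp
        | add x y hx hy => simp only [map_add, add_tmul, hx, hy]
        | tmul a b => simp [F, TensorProduct.tmul_smul, TensorProduct.smul_tmul']
      rw [LinearMap.rTensor_tmul, this, Coalgebra.lTensor_counit_comul]
      simp
  have h2 : ∀ s t : H ⊗[k] H, F ((TensorProduct.mk k H H 1).lTensor H s *
      TensorProduct.mk k H (H ⊗[k] H) 1 t) =
      s * (1 ⊗ₜ TensorProduct.lid k H ((counit (R := k)).rTensor H t)) := fun s t => by
    induction s with
    | zero => simp
    | add x y hx hy => simp only [map_add, add_mul, hx, hy]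
    | tmul a b =>
      induction t with
      | zero => simp
      | add x y hx hy => simp only [map_add, mul_add, tmul_add, hx, hy]
      | tmul c d => simp [F]
  have h3 := congrArg F hR.comul_left
  rw [h1, h2] at h3
  have h4 := hR.isUnit.mul_left_cancel ((mul_one R).trans h3)
  have h5 := congrArg (fun t => TensorProduct.lid k H ((counit (R := k)).rTensor H t)) h4
  simpa [Algebra.TensorProduct.one_def] using h5.symm

variable (k H) in
/-- The bilinear map `(a ⊗ b, c ⊗ d) ↦ a c ⊗ S(d) b`. -/
def twistProd : H ⊗[k] H →ₗ[k] H ⊗[k] H →ₗ[k] H ⊗[k] H :=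
  TensorProduct.map₂ (LinearMap.mul k H) (LinearMap.mul k H ∘ₗ antipode k).flip

@[simp]
theorem twistProd_tmul (a b c d : H) :
    twistProd k H (a ⊗ₜ b) (c ⊗ₜ d) = (a * c) ⊗ₜ (antipode k d * b) := rfl

/-- Apply S to the middle leg of R¹³ R¹² = (id ⊗ Δ)(R) and multiply the last two legs. In H ⊗ H^op
this says that (id ⊗ S)(R) is a right inverse of R, which is the order of factors in which two
copies of R meet in the computations with Δ_R. -/
theorem IsQuasitriangular.twistProd_self (hR : IsQuasitriangular R) : twistProd k H R R = 1 := by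
  let F : H ⊗[k] (H ⊗[k] H) →ₗ[k] H ⊗[k] H :=
    (LinearMap.mul' k H ∘ₗ (antipode k).rTensor H).lTensor H
  have h1 : ∀ t : H ⊗[k] H, F ((comul (R := k)).lTensor H t) =
      TensorProduct.rid k H ((counit (R := k)).lTensor H t) ⊗ₜ 1 := fun t => by
    induction t with
    | zero => simp
    | add x y hx hy => simp only [map_add, add_tmul, hx, hy]
    | tmul a b =>
      simp [F, Algebra.algebraMap_eq_smul_one, TensorProduct.tmul_smul, TensorProduct.smul_tmul']
  have h2 : ∀ s t : H ⊗[k] H, F ((TensorProduct.mk k H H 1).lTensor H s *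
      TensorProduct.assoc k H H H ((TensorProduct.mk k (H ⊗[k] H) H).flip 1 t)) =
      twistProd k H s t := fun s t => by
    induction s with
    | zero => simp
    | add x y hx hy => simp only [map_add, add_mul, LinearMap.add_apply, hx, hy]
    | tmul a b =>
      induction t with
      | zero => simp
      | add x y hx hy => simp only [map_add, mul_add, hx, hy]
      | tmul c d => simp [F]
  rw [← h2, ← hR.comul_right, h1, hR.counit_right, Algebra.TensorProduct.one_def]

/-- The relation `R Δ(h) = Δ^cop(h) R` in a convolution algebra. -/
theorem IsQuasitriangular.convHom_mul {A : Type*} [Ring A] [Algebra k A]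
    (hR : IsQuasitriangular R) (m : H ⊗[k] H →ₐ[k] A) :
    convConst k H (m R) * (convHom (m.comp (inl k H)) * convHom (m.comp (inr k H))) =
      convHom (m.comp (inr k H)) * convHom (m.comp (inl k H)) * convConst k H (m R) := by
  ext h
  change (convConst k H (m R) * (convHom (m.comp (inl k H)) * convHom (m.comp (inr k H)))) h =
    (convHom (m.comp (inr k H)) * convHom (m.comp (inl k H)) * convConst k H (m R)) h
  rw [convConst_mul_apply, mul_convConst_apply]
  have h1 : (convHom (m.comp (inl k H)) * convHom (m.comp (inr k H))) h = m (comul h) := by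
    rw [LinearMap.convMul_apply]
    generalize comul (R := k) h = d
    induction d with
    | zero => simp
    | add x y hx hy => simp only [map_add, hx, hy]
    | tmul a b => simp [convHom, ← map_mul]
  have h2 : (convHom (m.comp (inr k H)) * convHom (m.comp (inl k H))) h =
      m (TensorProduct.comm k H H (comul h)) := by
    rw [LinearMap.convMul_apply]
    generalize comul (R := k) h = d
    induction d with
    | zero => simp
    | add x y hx hy => simp only [map_add, hx, hy]
    | tmul a b => simp [convHom, ← map_mul]
  rw [h1, h2, ← map_mul, ← map_mul, hR.mul_comul]

end Quasitriangular

/-! ### Operators on `H ⊗ H` -/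

section Slots

variable {k H : Type*} [Field k] [Ring H] [HopfAlgebra k H]

variable (k H) in
/-- The operators `u ⊗ v ↦ h u ⊗ v`. -/
def slotL : H →ₐ[k] Module.End k (H ⊗[k] H) :=
  (Module.endTensorEndAlgHom (R := k) (A := k) (M := H) (N := H)).comp
    (Algebra.TensorProduct.includeLeft.comp (Algebra.lmul k H))

variable (k H) in
/-- The operators `u ⊗ v ↦ u S(h) ⊗ v`. -/
def slotS : H →ₐ[k] Module.End k (H ⊗[k] H) :=
  (Module.endTensorEndAlgHom (R := k) (A := k) (M := H) (N := H)).comp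
    (Algebra.TensorProduct.includeLeft.comp ((AlgHom.mulLeftRight k H).comp
      (Algebra.TensorProduct.includeRight.comp (antipodeAlgHomOp k H))))

variable (k H) in
/-- The operators `u ⊗ v ↦ u ⊗ (h ·_ad v)`. -/
def slotA : H →ₐ[k] Module.End k (H ⊗[k] H) :=
  (Module.endTensorEndAlgHom (R := k) (A := k) (M := H) (N := H)).comp
    (Algebra.TensorProduct.includeRight.comp (adAction k))

@[simp]
theorem slotL_tmul (h u v : H) : slotL k H h (u ⊗ₜ v) = (h * u) ⊗ₜ v := by
  simp [slotL, Module.endTensorEndAlgHom_apply]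

@[simp]
theorem slotS_tmul (h u v : H) : slotS k H h (u ⊗ₜ v) = (u * antipode k h) ⊗ₜ v := by
  simp [slotS, Module.endTensorEndAlgHom_apply]

@[simp]
theorem slotA_tmul (h u v : H) : slotA k H h (u ⊗ₜ v) = u ⊗ₜ adAction k h v := by
  simp [slotA, Module.endTensorEndAlgHom_apply]

theorem commute_slotL_slotS (x y : H) : Commute (slotL k H x) (slotS k H y) := by
  apply TensorProduct.ext'
  intro u v
  simp [Module.End.mul_apply, mul_assoc]

theorem commute_slotA_slotS (x y : H) : Commute (slotA k H x) (slotS k H y) := by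
  apply TensorProduct.ext'
  intro u v
  simp [Module.End.mul_apply]

theorem commute_slotA_slotL (x y : H) : Commute (slotA k H x) (slotL k H y) := by
  apply TensorProduct.ext'
  intro u v
  simp [Module.End.mul_apply]

variable (k H) in
/-- `x ⊗ y ↦ (u ⊗ v ↦ u S(y) ⊗ (x ·_ad v))`. -/
def slotAS : H ⊗[k] H →ₐ[k] Module.End k (H ⊗[k] H) :=
  Algebra.TensorProduct.lift (slotA k H) (slotS k H) commute_slotA_slotS

variable (k H) in
/-- `x ⊗ y ↦ (u ⊗ v ↦ y u ⊗ (x ·_ad v))`. -/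
def slotAL : H ⊗[k] H →ₐ[k] Module.End k (H ⊗[k] H) :=
  Algebra.TensorProduct.lift (slotA k H) (slotL k H) commute_slotA_slotL

@[simp]
theorem slotAS_tmul (x y u v : H) :
    slotAS k H (x ⊗ₜ y) (u ⊗ₜ v) = (u * antipode k y) ⊗ₜ adAction k x v := by
  simp [slotAS, Module.End.mul_apply]

@[simp]
theorem slotAL_tmul (x y u v : H) :
    slotAL k H (x ⊗ₜ y) (u ⊗ₜ v) = (y * u) ⊗ₜ adAction k x v := by
  simp [slotAL, Module.End.mul_apply]

theorem slotAS_comp_inl : (slotAS k H).comp (inl k H) = slotA k H :=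
  Algebra.TensorProduct.lift_comp_includeLeft ..

theorem slotAS_comp_inr : (slotAS k H).comp (inr k H) = slotS k H :=
  Algebra.TensorProduct.lift_comp_includeRight _ _ commute_slotA_slotS

theorem slotAL_comp_inl : (slotAL k H).comp (inl k H) = slotA k H :=
  Algebra.TensorProduct.lift_comp_includeLeft ..

theorem slotAL_comp_inr : (slotAL k H).comp (inr k H) = slotL k H :=
  Algebra.TensorProduct.lift_comp_includeRight _ _ commute_slotA_slotL

/-- Reading R as an operator on H ⊗ H lets commutation relations for R act on Δ_R directly. -/
theorem transmutedComul_apply (R : H ⊗[k] H) (a : H) :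
    transmutedComul R a = slotAS k H R (comul a) := by
  simp only [transmutedComul, LinearMap.comp_apply]
  generalize comul (R := k) a = d
  induction d with
  | zero => simp
  | add x y hx hy => simp only [map_add, hx, hy]
  | tmul u v =>
    induction R with
    | zero => simp
    | add x y hx hy => simp only [map_add, LinearMap.add_apply, ← hx, ← hy]
    | tmul x y => simp

theorem slotA_apply_eq (w : H ⊗[k] H) :
    toConv ((slotA k H).toLinearMap.flip w) =
      convHom (inr k H) * convConst k H w * convInvHom (inr k H) := by
  ext h
  change slotA k H h w = (convHom (inr k H) * convConst k H w * convInvHom (inr k H)) h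
  have h1 : convHom (inr k H) * convConst k H w =
      toConv (LinearMap.mulRight k w ∘ₗ (inr k H).toLinearMap) := by
    ext h
    exact mul_convConst_apply w _ h
  rw [h1, LinearMap.convMul_apply]
  induction w with
  | zero =>
    simp only [map_zero, LinearMap.mulRight_zero_eq_zero, LinearMap.zero_comp]
    simp
  | add x y hx hy =>
    have : toConv (LinearMap.mulRight k (x + y) ∘ₗ (inr k H).toLinearMap) =
        toConv (LinearMap.mulRight k x ∘ₗ (inr k H).toLinearMap) +
        toConv (LinearMap.mulRight k y ∘ₗ (inr k H).toLinearMap) := by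
      ext; simp [mul_add]
    have hxy := fun (z : H ⊗[k] H) => mul_convConst_apply z (convHom (inr k H))
    rw [map_add, hx (by ext h; exact mul_convConst_apply x _ h),
      hy (by ext h; exact mul_convConst_apply y _ h), this, ofConv_add, TensorProduct.map_add_left,
      LinearMap.add_apply, map_add]
  | tmul u v =>
    rw [slotA_tmul, adAction_apply]
    generalize comul (R := k) h = d
    induction d with
    | zero => simp
    | add x y hx hy => simp only [map_add, tmul_add, hx, hy]
    | tmul x y => simp [convInvHom]

/-- `Δ(h ·_ad a)` as an operator applied to `Δ(a)`. -/
theorem comul_adAction (h a : H) : comul (R := k) (adAction k h a) =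
    (convHom (slotL k H) * (convHom (slotA k H) * convHom (slotS k H))) h (comul a) := by
  have h1 : ∀ w : H ⊗[k] H, toConv ((convHom (slotA k H) *
      convHom (slotS k H)).ofConv.flip w) =
      toConv ((slotA k H).toLinearMap.flip w) * convInvHom (inl k H) := fun w => by
    ext h
    change (convHom (slotA k H) * convHom (slotS k H)) h w =
      (toConv ((slotA k H).toLinearMap.flip w) * convInvHom (inl k H)) h
    rw [LinearMap.convMul_apply, LinearMap.convMul_apply]
    generalize comul (R := k) h = d
    induction d with
    | zero => simp
    | add x y hx hy => simp only [map_add, LinearMap.add_apply, hx, hy]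
    | tmul x y =>
      induction w with
      | zero => simp
      | add s t hs ht =>
        simp only [map_tmul, LinearMap.mul'_apply, LinearMap.flip_apply] at hs ht ⊢
        simp only [map_add, add_mul, hs, ht]
      | tmul u v => simp [convInvHom, convHom, Module.End.mul_apply]
  have h2 : ∀ w : H ⊗[k] H, toConv ((convHom (slotL k H) * (convHom (slotA k H) *
      convHom (slotS k H))).ofConv.flip w) =
      convHom (inl k H) * toConv ((convHom (slotA k H) *
      convHom (slotS k H)).ofConv.flip w) := fun w => by
    ext h
    change (convHom (slotL k H) * (convHom (slotA k H) * convHom (slotS k H))) h w =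
      (convHom (inl k H) * toConv ((convHom (slotA k H) *
      convHom (slotS k H)).ofConv.flip w)) h
    rw [LinearMap.convMul_apply, LinearMap.convMul_apply]
    generalize convHom (slotA k H) * convHom (slotS k H) = K
    generalize comul (R := k) h = d
    induction d with
    | zero => simp
    | add x y hx hy => simp only [map_add, LinearMap.add_apply, hx, hy]
    | tmul x y =>
      simp only [map_tmul, LinearMap.mul'_apply, LinearMap.flip_apply,
        Module.End.mul_apply]
      generalize K.ofConv y w = z
      induction z with
      | zero => simp
      | add s t hs ht => simp only [map_add, mul_add, hs, ht]
      | tmul u v => simp [convHom]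
  -- h ↦ Δ(h · a) is the conjugate of the constant Δ(a) by Δ = `inl` * `inr`. The inner conjugation
  -- by `inr` is the adjoint action on the second factor; the outer one by `inl` gives the two
  -- multiplications on the first.
  have h3 : toConv (comul (R := k) ∘ₗ (adAction k).toLinearMap.flip a) =
      convHom (Bialgebra.comulAlgHom k H) * convConst k H (comul a) *
        convInvHom (Bialgebra.comulAlgHom k H) := by
    ext h
    change comul (R := k) (adAction k h a) = (convHom (Bialgebra.comulAlgHom k H) *
      convConst k H (comul (R := k) a) * convInvHom (Bialgebra.comulAlgHom k H)) h
    have h1 : convHom (Bialgebra.comulAlgHom k H) * convConst k H (comul (R := k) a) =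
        toConv (LinearMap.mulRight k (comul a) ∘ₗ (Bialgebra.comulAlgHom k H).toLinearMap) := by
      ext h
      exact mul_convConst_apply _ _ h
    rw [h1, LinearMap.convMul_apply, adAction_apply]
    generalize comul (R := k) h = d
    induction d with
    | zero => simp
    | add x y hx hy => simp only [map_add, hx, hy]
    | tmul x y => simp [convInvHom]
  have h4 : toConv (comul (R := k) ∘ₗ (adAction k).toLinearMap.flip a) =
      toConv ((convHom (slotL k H) * (convHom (slotA k H) *
        convHom (slotS k H))).ofConv.flip (comul (R := k) a)) := by
    rw [h3, h2, h1, slotA_apply_eq, convHom_comul, convInvHom_comul]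
    simp only [mul_assoc]
  exact congrArg (fun f => f h) h4

theorem commute_slotAS_slotL (t : H ⊗[k] H) (x : H) : Commute (slotAS k H t) (slotL k H x) := by
  induction t with
  | zero => rw [map_zero]; exact Commute.zero_left _
  | add s t hs ht => rw [map_add]; exact hs.add_left ht
  | tmul a b =>
    rw [slotAS, Algebra.TensorProduct.lift_tmul]
    exact (commute_slotA_slotL a x).mul_left (commute_slotL_slotS x b).symm

theorem commute_slotAL_slotS (t : H ⊗[k] H) (x : H) : Commute (slotAL k H t) (slotS k H x) := by
  induction t with
  | zero => rw [map_zero]; exact Commute.zero_left _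
  | add s t hs ht => rw [map_add]; exact hs.add_left ht
  | tmul a b =>
    rw [slotAL, Algebra.TensorProduct.lift_tmul]
    exact (commute_slotA_slotS a x).mul_left (commute_slotL_slotS b x)

/-- A constant which commutes with the values of a map commutes with the map. -/
theorem convConst_mul_comm {A : Type*} [Ring A] [Algebra k A] {a : A} {f : WithConv (H →ₗ[k] A)}
    (h : ∀ x, Commute a (f x)) : convConst k H a * f = f * convConst k H a := by
  ext x
  change (convConst k H a * f) x = (f * convConst k H a) x
  rw [convConst_mul_apply, mul_convConst_apply, (h x).eq]

theorem convHom_slotL_mul_slotS (h u v : H) :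
    (convHom (slotL k H) * convHom (slotS k H)) h (u ⊗ₜ v) = adAction k h u ⊗ₜ v := by
  rw [LinearMap.convMul_apply, adAction_apply]
  generalize comul (R := k) h = d
  induction d with
  | zero => simp
  | add x y hx hy => simp only [map_add, LinearMap.add_apply, add_tmul, hx, hy]
  | tmul x y => simp [convHom, Module.End.mul_apply, mul_assoc]

/-- `Δ_R` is linear with respect to the adjoint action. -/
theorem transmutedComul_adAction {R : H ⊗[k] H} (hR : IsQuasitriangular R) (h a : H) :
    transmutedComul R (adAction k h a) =
      (convHom (slotL k H) * convHom (slotS k H) * convHom (slotA k H)) h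
        (transmutedComul R a) := by
  -- The operator of R commutes with left multiplication on the first factor, and R Δ = Δ^cop R
  -- interchanges the other two. The two multiplications on the first factor then become adjacent
  -- and combine to the adjoint action.
  have h1 : convConst k H (slotAS k H R) * (convHom (slotL k H) * (convHom (slotA k H) *
      convHom (slotS k H))) = convHom (slotL k H) * convHom (slotS k H) * convHom (slotA k H) *
        convConst k H (slotAS k H R) := by
    have h2 := hR.convHom_mul (slotAS k H)
    rw [slotAS_comp_inl, slotAS_comp_inr] at h2
    rw [← mul_assoc, convConst_mul_comm (fun x => commute_slotAS_slotL R x), mul_assoc, h2]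
    simp only [mul_assoc]
  rw [transmutedComul_apply, transmutedComul_apply, comul_adAction]
  have h3 := congrArg (fun f => f h (comul (R := k) a)) h1
  change (convConst k H (slotAS k H R) * (convHom (slotL k H) * (convHom (slotA k H) *
      convHom (slotS k H)))) h (comul (R := k) a) = (convHom (slotL k H) * convHom (slotS k H) *
        convHom (slotA k H) * convConst k H (slotAS k H R)) h (comul (R := k) a) at h3
  rw [convConst_mul_apply, mul_convConst_apply] at h3
  exact h3

/-- `Δ_R(h ·_ad g) = ∑ (h₁ ·_ad g) ⊗ (h₂ ·_ad g)` for a grouplike element `g`. -/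
theorem transmutedComul_adAction_groupLike {R : H ⊗[k] H} (hR : IsQuasitriangular R) {g : H}
    (hg : IsTransmutedGroupLike R g) (h : H) : transmutedComul R (adAction k h g) =
      TensorProduct.map ((adAction k).toLinearMap.flip g) ((adAction k).toLinearMap.flip g)
        (comul h) := by
  rw [transmutedComul_adAction hR, hg.2, LinearMap.convMul_apply]
  generalize comul (R := k) h = d
  induction d with
  | zero => simp
  | add x y hx hy => simp only [map_add, LinearMap.add_apply, hx, hy]
  | tmul x y =>
    have := convHom_slotL_mul_slotS (k := k) x g (adAction k y g)
    simpa [convHom, Module.End.mul_apply] using this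

end Slots

/-! ### The braided antipode -/

section BraidedAntipode

variable {k H : Type*} [Field k] [Ring H] [HopfAlgebra k H]

/-- The map `t ⊗ b ↦ t² S(t¹ ·_ad b)`. -/
def preBraidedAntipode : H ⊗[k] H →ₗ[k] H →ₗ[k] H :=
  TensorProduct.lift (LinearMap.mk₂ k
    (fun x y => LinearMap.mulLeft k y ∘ₗ antipode k ∘ₗ adAction k x)
    (fun x x' y => by ext; simp [mul_add])
    (fun c x y => by ext; simp)
    (fun x y y' => by ext; simp [add_mul])
    (fun c x y => by ext; simp))

@[simp]
theorem preBraidedAntipode_tmul (x y b : H) :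
    preBraidedAntipode (k := k) (x ⊗ₜ y) b = y * antipode k (adAction k x b) := rfl

/-- `S_R(h ·_ad b) = h ·_ad S_R(b)`, where `S_R(b) = R² S(R¹ ·_ad b)`. -/
theorem preBraidedAntipode_adAction {R : H ⊗[k] H} (hR : IsQuasitriangular R) (h b : H) :
    preBraidedAntipode R (adAction k h b) = adAction k h (preBraidedAntipode R b) := by
  have h0 : ∀ t : H ⊗[k] H, preBraidedAntipode t (adAction k h b) =
      preBraidedAntipode (t * (h ⊗ₜ 1)) b := fun t => by
    induction t with
    | zero => simp
    | add x y hx hy => simp only [map_add, LinearMap.add_apply, add_mul, hx, hy]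
    | tmul x y => simp [Module.End.mul_apply]
  -- This is R (h ⊗ 1) = ∑ (1 ⊗ h₁)(h₂ ⊗ 1) R (1 ⊗ S(h₃)), obtained from R Δ = Δ^cop R by cancelling
  -- the second leg of Δ.
  have h1 : convConst k H R * convHom (inl k H) = convHom (inr k H) *
      (convHom (inl k H) * (convConst k H R * convInvHom (inr k H))) := by
    have := hR.convHom_mul (AlgHom.id k (H ⊗[k] H))
    simp only [AlgHom.id_comp, AlgHom.coe_id, id_eq] at this
    rw [← mul_assoc (convHom (inl k H)), ← mul_assoc (convHom (inr k H)),
      ← mul_assoc (convHom (inr k H)), ← this, mul_assoc, mul_assoc, convHom_mul_convInvHom,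
      mul_one]
  have h2 : ∀ (t : H ⊗[k] H) (y : H), preBraidedAntipode
      ((convHom (inl k H) * (convConst k H t * convInvHom (inr k H))) y) b =
      preBraidedAntipode t b * antipode k y := fun t y => by
    have h3 : convConst k H t * convInvHom (inr k H) =
        toConv (LinearMap.mulLeft k t ∘ₗ (inr k H).toLinearMap ∘ₗ antipode k) := by
      ext h
      exact convConst_mul_apply t _ h
    -- The identity ∑ (y₁ · z) y₂ = y z removes the adjoint action inside the antipode, leaving S(y
    -- z) = S(z) S(y).
    have h4 : ∀ z, LinearMap.mul' k H (TensorProduct.map ((adAction k).toLinearMap.flip z)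
        LinearMap.id (comul y)) = y * z := fun z => by
      have := congrArg (fun f => f y) (adOn_mul_id (k := k) z)
      change (adOn k z * convHom (AlgHom.id k H)) y =
        (convHom (AlgHom.id k H) * convConst k H z) y at this
      rw [mul_convConst_apply] at this
      exact this
    rw [h3, LinearMap.convMul_apply]
    induction t with
    | zero => simp
    | add x y hx hy =>
      have : toConv (LinearMap.mulLeft k (x + y) ∘ₗ (inr k H).toLinearMap ∘ₗ antipode k) =
          toConv (LinearMap.mulLeft k x ∘ₗ (inr k H).toLinearMap ∘ₗ antipode k) +
          toConv (LinearMap.mulLeft k y ∘ₗ (inr k H).toLinearMap ∘ₗ antipode k) := by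
        ext; simp [add_mul]
      rw [this, ofConv_add, TensorProduct.map_add_right, LinearMap.add_apply, map_add, map_add,
        LinearMap.add_apply, hx (by ext h; exact convConst_mul_apply x _ h),
        hy (by ext h; exact convConst_mul_apply y _ h), map_add, LinearMap.add_apply, add_mul]
    | tmul u v =>
      rw [preBraidedAntipode_tmul, mul_assoc, ← antipode_mul_antidistrib, ← h4]
      generalize comul (R := k) y = d
      induction d with
      | zero => simp
      | add x y hx hy => simp only [map_add, LinearMap.add_apply, mul_add, hx, hy]
      | tmul x y => simp [convHom, Module.End.mul_apply, antipode_mul_antidistrib, mul_assoc]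
  rw [h0, ← show (convConst k H R * convHom (inl k H)) h = R * (h ⊗ₜ 1) from
    convConst_mul_apply R _ h, h1, LinearMap.convMul_apply, adAction_apply]
  generalize hK : convHom (inl k H) * (convConst k H R * convInvHom (inr k H)) = K at h2
  generalize comul (R := k) h = d
  induction d with
  | zero => simp
  | add x y hx hy => simp only [map_add, LinearMap.add_apply, hx, hy]
  | tmul x y =>
    have h5 : ∀ t : H ⊗[k] H, preBraidedAntipode ((1 ⊗ₜ x) * t) b = x * preBraidedAntipode t b :=
      fun t => by
      induction t with
      | zero => simp
      | add s t hs ht => simp only [map_add, LinearMap.add_apply, mul_add, hs, ht]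
      | tmul u v => simp [mul_assoc]
    have h6 := h2 R y
    rw [hK] at h6
    change preBraidedAntipode ((1 ⊗ₜ x) * K y) b = _
    rw [h5, h6]
    simp [mul_assoc]

/-- `∑ a₍₁₎ S_R(a₍₂₎) = ε(a)`, with respect to `Δ_R`. -/
theorem mul_preBraidedAntipode_transmutedComul {R : H ⊗[k] H} (hR : IsQuasitriangular R) (a : H) :
    LinearMap.mul' k H ((preBraidedAntipode R).lTensor H (transmutedComul R a)) =
      counit (R := k) a • 1 := by
  -- The copy of R from Δ_R and the copy from S_R combine to the twisted product, which is 1; what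
  -- remains is ∑ a₁ S(a₂).
  have key : ∀ (s t : H ⊗[k] H) (u v : H),
      LinearMap.mul' k H ((preBraidedAntipode t).lTensor H (slotAS k H s (u ⊗ₜ v))) =
      u * preBraidedAntipode (twistProd k H t s) v := fun s t u v => by
    induction s with
    | zero => simp
    | add x y hx hy => simp only [map_add, LinearMap.add_apply, mul_add, hx, hy]
    | tmul x y =>
      induction t with
      | zero => simp
      | add p q hp hq =>
        simp only [map_add, LinearMap.add_apply, mul_add, hp, hq, LinearMap.lTensor_add]
      | tmul p q => simp [Module.End.mul_apply, mul_assoc]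
  rw [transmutedComul_apply, ← Algebra.algebraMap_eq_smul_one,
    ← mul_antipode_lTensor_comul_apply (R := k) a]
  generalize comul (R := k) a = d
  induction d with
  | zero => simp
  | add x y hx hy => simp only [map_add, hx, hy]
  | tmul u v =>
    rw [key, hR.twistProd_self, Algebra.TensorProduct.one_def]
    simp

variable (k H) in
/-- `x ⊗ y ↦ (u ⊗ v ↦ u y ⊗ (x ·_ad v))`. -/
def slotAR : H ⊗[k] H →ₗ[k] Module.End k (H ⊗[k] H) :=
  (Module.endTensorEndAlgHom (R := k) (A := k) (M := H) (N := H)).toLinearMap ∘ₗ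
    TensorProduct.map (LinearMap.mul k H).flip (adAction k).toLinearMap ∘ₗ
    (TensorProduct.comm k H H).toLinearMap

@[simp]
theorem slotAR_tmul (x y u v : H) :
    slotAR k H (x ⊗ₜ y) (u ⊗ₜ v) = (u * y) ⊗ₜ adAction k x v := by
  simp [slotAR, Module.endTensorEndAlgHom_apply]

/-- `Δ(a) = ∑ a₍₁₎ R² ⊗ (R¹ ·_ad a₍₂₎)`, with respect to `Δ_R` on the right hand side. -/
theorem comul_eq_slotAR {R : H ⊗[k] H} (hR : IsQuasitriangular R) (a : H) :
    comul a = slotAR k H R (transmutedComul R a) := by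
  have key : ∀ (s t : H ⊗[k] H) (u v : H), slotAR k H t (slotAS k H s (u ⊗ₜ v)) =
      slotAR k H (twistProd k H t s) (u ⊗ₜ v) := fun s t u v => by
    induction s with
    | zero => simp
    | add x y hx hy => simp only [map_add, LinearMap.add_apply, hx, hy]
    | tmul x y =>
      induction t with
      | zero => simp
      | add p q hp hq => simp only [map_add, LinearMap.add_apply, hp, hq]
      | tmul p q => simp [Module.End.mul_apply, mul_assoc]
  rw [transmutedComul_apply]
  generalize comul (R := k) a = d
  induction d with
  | zero => simp
  | add x y hx hy => simp only [map_add, ← hx, ← hy]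
  | tmul u v =>
    rw [key, hR.twistProd_self, Algebra.TensorProduct.one_def]
    simp

end BraidedAntipode

/-! ### Grouplike elements of the transmuted braided group -/

section GroupLike

variable {k H : Type*} [Field k] [Ring H] [HopfAlgebra k H] {R : H ⊗[k] H} {g : H}

theorem IsTransmutedGroupLike.mul_inv (hR : IsQuasitriangular R) (hg : IsTransmutedGroupLike R g) :
    g * preBraidedAntipode R g = 1 := by
  have := mul_preBraidedAntipode_transmutedComul hR g
  rwa [hg.1, hg.2, LinearMap.lTensor_tmul, LinearMap.mul'_apply, one_smul] at this

/-- A semisimple ring is Dedekind-finite, so the right inverse of g supplied by the braided antipode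
axiom is also a left inverse. -/
theorem IsTransmutedGroupLike.inv_mul [IsSemisimpleRing H] (hR : IsQuasitriangular R)
    (hg : IsTransmutedGroupLike R g) : preBraidedAntipode R g * g = 1 :=
  mul_eq_one_symm (hg.mul_inv hR)

theorem IsTransmutedGroupLike.comul_eq (hR : IsQuasitriangular R)
    (hg : IsTransmutedGroupLike R g) : comul g = slotAR k H R (g ⊗ₜ g) := by
  rw [comul_eq_slotAR hR, hg.2]

/-- The product of `∑ x R² ⊗ (R¹ · x')` and `∑ R² y ⊗ (R¹ · y')`. -/
theorem slotAR_mul_slotAL (hR : IsQuasitriangular R) (x x' y y' : H) :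
    slotAR k H R (x ⊗ₜ x') * slotAL k H R (y ⊗ₜ y') =
      TensorProduct.map (LinearMap.mulLeft k x ∘ₗ LinearMap.mulRight k y)
        ((adAction k).toLinearMap.flip (x' * y')) (TensorProduct.comm k H H R) := by
  -- F sends R¹³ R²³ to the product on the left. On (Δ ⊗ id)(R), the module algebra law merges the
  -- actions on x' and y' into one action on x' y'.
  let F : H ⊗[k] (H ⊗[k] H) →ₗ[k] H ⊗[k] H :=
    (TensorProduct.comm k H H).toLinearMap ∘ₗ TensorProduct.map
      (LinearMap.mul' k H ∘ₗ TensorProduct.map ((adAction k).toLinearMap.flip x')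
        ((adAction k).toLinearMap.flip y'))
      (LinearMap.mulLeft k x ∘ₗ LinearMap.mulRight k y) ∘ₗ
      (TensorProduct.assoc k H H H).symm.toLinearMap
  have h1 : ∀ t : H ⊗[k] H, F (TensorProduct.assoc k H H H ((comul (R := k)).rTensor H t)) =
      TensorProduct.map (LinearMap.mulLeft k x ∘ₗ LinearMap.mulRight k y)
        ((adAction k).toLinearMap.flip (x' * y')) (TensorProduct.comm k H H t) := fun t => by
    induction t with
    | zero => simp
    | add x y hx hy => simp only [map_add, hx, hy]
    | tmul a b => simp [F, adAction_mul]
  have h2 : ∀ s t : H ⊗[k] H, F ((TensorProduct.mk k H H 1).lTensor H s *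
      TensorProduct.mk k H (H ⊗[k] H) 1 t) =
      slotAR k H s (x ⊗ₜ x') * slotAL k H t (y ⊗ₜ y') := fun s t => by
    induction s with
    | zero => simp
    | add x y hx hy => simp only [map_add, add_mul, LinearMap.add_apply, hx, hy]
    | tmul a b =>
      induction t with
      | zero => simp
      | add x y hx hy => simp only [map_add, mul_add, LinearMap.add_apply, hx, hy]
      | tmul c d => simp [F, mul_assoc]
  rw [← h2, ← hR.comul_left, h1]

/-- The right-hand side is a right inverse of Δ(g): in the product, R¹ acts on g g⁻¹ = 1 through ε
and ε(R¹) R² = 1, so R disappears. Uniqueness of inverses does the rest. -/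
theorem IsTransmutedGroupLike.comul_inv [IsSemisimpleRing H] (hR : IsQuasitriangular R)
    (hg : IsTransmutedGroupLike R g) : comul (preBraidedAntipode R g) =
      slotAL k H R (preBraidedAntipode R g ⊗ₜ preBraidedAntipode R g) := by
  refine left_inv_eq_right_inv (a := comul (R := k) g) ?_ ?_
  · rw [← Bialgebra.comul_mul, hg.inv_mul hR, Bialgebra.comul_one]
  · rw [hg.comul_eq hR, slotAR_mul_slotAL hR, hg.mul_inv hR]
    have : ∀ t : H ⊗[k] H, TensorProduct.map
        (LinearMap.mulLeft k g ∘ₗ LinearMap.mulRight k (preBraidedAntipode R g))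
        ((adAction k).toLinearMap.flip 1) (TensorProduct.comm k H H t) =
        (g * (TensorProduct.lid k H ((counit (R := k)).rTensor H t) *
          preBraidedAntipode R g)) ⊗ₜ 1 := fun t => by
      induction t with
      | zero => simp
      | add x y hx hy => simp only [map_add, mul_add, add_mul, add_tmul, hx, hy]
      | tmul a b => simp [TensorProduct.tmul_smul, TensorProduct.smul_tmul']
    rw [this, hR.counit_left, one_mul, hg.mul_inv hR, Algebra.TensorProduct.one_def]

/-- `Δ(h · g⁻¹) = ∑ R² (h₂ · g⁻¹) ⊗ R¹ · (h₁ · g⁻¹)`. -/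
theorem IsTransmutedGroupLike.comul_adAction_inv [IsSemisimpleRing H] (hR : IsQuasitriangular R)
    (hg : IsTransmutedGroupLike R g) (h : H) :
    comul (adAction k h (preBraidedAntipode R g)) = slotAL k H R (TensorProduct.comm k H H
      (TensorProduct.map ((adAction k).toLinearMap.flip (preBraidedAntipode R g))
        ((adAction k).toLinearMap.flip (preBraidedAntipode R g)) (comul h))) := by
  generalize hg' : preBraidedAntipode R g = g'
  -- R Δ = Δ^cop R moves R to the left of the action of h, reversing the roles of the factors; this
  -- is why the two legs occur flipped.
  have h1 : convHom (slotL k H) * (convHom (slotA k H) * convHom (slotS k H)) *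
      convConst k H (slotAL k H R) = convConst k H (slotAL k H R) *
        (convHom (slotA k H) * (convHom (slotL k H) * convHom (slotS k H))) := by
    have h2 := hR.convHom_mul (slotAL k H)
    rw [slotAL_comp_inl, slotAL_comp_inr] at h2
    rw [mul_assoc, mul_assoc, ← convConst_mul_comm (fun x => commute_slotAL_slotS R x),
      ← mul_assoc, ← mul_assoc, ← h2]
    simp only [mul_assoc]
  have h3 := congrArg (fun f => f h (g' ⊗ₜ[k] g')) h1
  change (convHom (slotL k H) * (convHom (slotA k H) * convHom (slotS k H)) *
      convConst k H (slotAL k H R)) h (g' ⊗ₜ[k] g') = (convConst k H (slotAL k H R) *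
        (convHom (slotA k H) * (convHom (slotL k H) * convHom (slotS k H)))) h
          (g' ⊗ₜ[k] g') at h3
  rw [convConst_mul_apply, mul_convConst_apply, Module.End.mul_apply, Module.End.mul_apply] at h3
  rw [comul_adAction, ← hg', hg.comul_inv hR, hg', h3, LinearMap.convMul_apply]
  congr 1
  generalize comul (R := k) h = d
  induction d with
  | zero => simp
  | add x y hx hy => simp only [map_add, LinearMap.add_apply, hx, hy]
  | tmul x y =>
    have := convHom_slotL_mul_slotS (k := k) y g' g'
    change slotA k H x ((convHom (slotL k H) * convHom (slotS k H)) y (g' ⊗ₜ[k] g')) = _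
    rw [this]
    simp

/-- With `y(h) = g (h · g⁻¹)`, an integral satisfies `l(y(h)) 1 = ∑ l(y(h₁)) y(h₂)`. -/
theorem IsTransmutedGroupLike.integral_apply [IsSemisimpleRing H] (hR : IsQuasitriangular R)
    (hg : IsTransmutedGroupLike R g) {l : Module.Dual k H}
    (hl : ∀ a, TensorProduct.rid k H (l.lTensor H (comul a)) = l a • 1)
    (hlad : ∀ h a : H, l (adAction k h a) = counit (R := k) h * l a) (h : H) :
    l (g * adAction k h (preBraidedAntipode R g)) • (1 : H) =
      g * TensorProduct.lid k H (TensorProduct.map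
        (l ∘ₗ LinearMap.mulLeft k g ∘ₗ (adAction k).toLinearMap.flip (preBraidedAntipode R g))
        ((adAction k).toLinearMap.flip (preBraidedAntipode R g)) (comul h)) := by
  rw [← hl, Bialgebra.comul_mul, hg.comul_eq hR, hg.comul_adAction_inv hR]
  generalize preBraidedAntipode R g = g'
  generalize comul (R := k) h = d
  induction d with
  | zero => simp
  | add x y hx hy => simp only [map_add, mul_add, hx, hy]
  | tmul x y =>
    rw [TensorProduct.map_tmul, TensorProduct.comm_tmul, slotAR_mul_slotAL hR]
    -- The second leg is R¹ · b, and l(R¹ · b) = ε(R¹) l(b). Invariance of l thus reduces R to ε(R¹)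
    -- R² = 1.
    have : ∀ (t : H ⊗[k] H) (a b : H), TensorProduct.rid k H (l.lTensor H (TensorProduct.map
        (LinearMap.mulLeft k g ∘ₗ LinearMap.mulRight k a)
        ((adAction k).toLinearMap.flip b) (TensorProduct.comm k H H t))) =
        l b • (g * (TensorProduct.lid k H ((counit (R := k)).rTensor H t) * a)) := fun t a b => by
      induction t with
      | zero => simp
      | add x y hx hy => simp only [map_add, mul_add, add_mul, smul_add, hx, hy]
      | tmul p q => simp [hlad, smul_smul, mul_comm]
    rw [this, hR.counit_left]
    simp

/-- The functional `θ(b) = l(g S_R(b))`. -/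
def lineIntegral (R : H ⊗[k] H) (g : H) (l : Module.Dual k H) : Module.Dual k H :=
  l ∘ₗ LinearMap.mulLeft k g ∘ₗ preBraidedAntipode R

theorem lineIntegral_apply (R : H ⊗[k] H) (g : H) (l : Module.Dual k H) (b : H) :
    lineIntegral R g l b = l (g * preBraidedAntipode R b) := rfl

theorem lineIntegral_self (hR : IsQuasitriangular R) (hg : IsTransmutedGroupLike R g)
    {l : Module.Dual k H} (hl1 : l 1 = 1) : lineIntegral R g l g = 1 := by
  rw [lineIntegral_apply, hg.mul_inv hR, hl1]

/-- `∑ θ(h₁ · g) (h₂ · g) = θ(h · g) g`. -/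
theorem lineIntegral_adAction [IsSemisimpleRing H] (hR : IsQuasitriangular R)
    (hg : IsTransmutedGroupLike R g) {l : Module.Dual k H}
    (hl : ∀ a, TensorProduct.rid k H (l.lTensor H (comul a)) = l a • 1)
    (hlad : ∀ h a : H, l (adAction k h a) = counit (R := k) h * l a) (h : H) :
    TensorProduct.lid k H (TensorProduct.map
      (lineIntegral R g l ∘ₗ (adAction k).toLinearMap.flip g)
      ((adAction k).toLinearMap.flip g) (comul h)) = lineIntegral R g l (adAction k h g) • g := by
  -- t(h) = θ(h · g) 1 has scalar values, so it commutes with constants.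
  let t : WithConv (H →ₗ[k] H) := toConv (LinearMap.toSpanSingleton k H 1 ∘ₗ
    lineIntegral R g l ∘ₗ (adAction k).toLinearMap.flip g)
  have ht : ∀ x, t x = l (g * adAction k x (preBraidedAntipode R g)) • (1 : H) := fun x => by
    rw [← preBraidedAntipode_adAction hR]
    rfl
  have htg : ∀ (f : WithConv (H →ₗ[k] H)) (x : H), (t * f) x = TensorProduct.lid k H
      (TensorProduct.map (lineIntegral R g l ∘ₗ (adAction k).toLinearMap.flip g)
        f.ofConv (comul x)) := fun f x => by
    rw [LinearMap.convMul_apply]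
    generalize comul (R := k) x = d
    induction d with
    | zero => simp
    | add x y hx hy => simp only [map_add, hx, hy]
    | tmul x y => simp [t]
  have hcomm : ∀ a : H, convConst k H a * t = t * convConst k H a := fun a =>
    convConst_mul_comm fun x => by
      rw [ht]; exact (Commute.one_right a).smul_right _
  -- This is the integral identity for l, with S_R(h · g) = h · g⁻¹. Convolving on the right with h
  -- ↦ h · g cancels the last factor.
  have h1 : t = t * convConst k H g * adOn k (preBraidedAntipode R g) := by
    rw [← hcomm, mul_assoc]
    ext x
    change t x = (convConst k H g * (t * adOn k (preBraidedAntipode R g))) x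
    rw [convConst_mul_apply, ht, hg.integral_apply hR hl hlad, htg]
    congr 3
    ext z
    simp [lineIntegral_apply, preBraidedAntipode_adAction hR]
  have h2 : t * adOn k g = t * convConst k H g := by
    conv_lhs => rw [h1]
    rw [mul_assoc, adOn_mul, hg.inv_mul hR, adOn_one, mul_one]
  have h3 := htg (adOn k g) h
  rw [h2, mul_convConst_apply] at h3
  refine h3.symm.trans ?_
  change (lineIntegral R g l (adAction k h g) • (1 : H)) * g = _
  simp

end GroupLike

/-! ### Minimal adjoint-stable subcoalgebras -/

section Minimal

variable {k H : Type*} [Field k] [Ring H] [HopfAlgebra k H] {R : H ⊗[k] H} {D : Submodule k H}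
  {g : H}

/-- A minimal adjoint-stable subcoalgebra with a grouplike element `g` equals `H ·_ad g`. -/
theorem IsMinimalAdjointStable.eq_range (hR : IsQuasitriangular R)
    (hD : IsMinimalAdjointStable R D) (hgD : g ∈ D) (hg : IsTransmutedGroupLike R g) :
    D = LinearMap.range ((adAction k).toLinearMap.flip g) := by
  have hle : LinearMap.range ((adAction k).toLinearMap.flip g) ≤ D := by
    rintro _ ⟨h, rfl⟩
    exact hD.1.2.1 h g hgD
  refine le_antisymm (hD.2 ⟨?_, ?_, ?_⟩ hle) hle
  · rintro _ ⟨h, rfl⟩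
    change transmutedComul R (adAction k h g) ∈ _
    rw [transmutedComul_adAction_groupLike hR hg]
    generalize comul (R := k) h = d
    induction d with
    | zero => rw [map_zero]; exact Submodule.zero_mem _
    | add x y hx hy => rw [map_add]; exact Submodule.add_mem _ hx hy
    | tmul x y => exact ⟨⟨_, x, rfl⟩ ⊗ₜ ⟨_, y, rfl⟩, rfl⟩
  · rintro h _ ⟨h', rfl⟩
    exact ⟨h * h', by simp [Module.End.mul_apply]⟩
  · intro h0
    have : g ∈ LinearMap.range ((adAction k).toLinearMap.flip g) := ⟨1, by simp⟩
    rw [h0, Submodule.mem_bot] at this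
    have h1 := hg.1
    rw [this, map_zero] at h1
    exact zero_ne_one h1

end Minimal

/-! ### The algebra of the line spanned by a grouplike element -/

section Line

variable {k H : Type*} [Field k] [Ring H] [HopfAlgebra k H] {g : H}

theorem mem_adStabilizer {h : H} : h ∈ adStabilizer k g ↔
    ((adAction k).toLinearMap.flip g).rTensor H (comul h) = g ⊗ₜ h := Iff.rfl

variable (k) in
/-- The generator `g` of the line `k g`. -/
def lineGen (g : H) : k ∙ g := ⟨g, Submodule.mem_span_singleton_self g⟩

variable (k) in
/-- The restriction of the counit to the line `k g`. -/
def lineCounit (g : H) : Module.Dual k (k ∙ g) := counit ∘ₗ (k ∙ g).subtype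

theorem lineCounit_smul_lineGen (hg : counit (R := k) g = 1) (w : k ∙ g) :
    lineCounit k g w • lineGen k g = w := by
  obtain ⟨w, hw⟩ := w
  obtain ⟨c, rfl⟩ := Submodule.mem_span_singleton.1 hw
  ext
  simp [lineCounit, lineGen, hg]

theorem lineCounit_lineGen (hg : counit (R := k) g = 1) : lineCounit k g (lineGen k g) = 1 := hg

theorem apply_lineGen_smul_lineCounit (hg : counit (R := k) g = 1) (a : Module.Dual k (k ∙ g)) :
    a (lineGen k g) • lineCounit k g = a := by
  ext w
  conv_rhs => rw [← lineCounit_smul_lineGen hg w]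
  simp [mul_comm]

/-- For the line `k g` the contraction is bijective. -/
def contractEquiv (hg : counit (R := k) g = 1) : DualHW k H (k ∙ g) ≃ₗ[k] H :=
  LinearEquiv.ofLinearMap DualHW.contract
    (DualHW.of.toLinearMap ∘ₗ TensorProduct.mk k _ _ (lineCounit k g) ∘ₗ
      (TensorProduct.mk k H (k ∙ g)).flip (lineGen k g))
    (by
      ext h
      change DualHW.contract (DualHW.of (lineCounit k g ⊗ₜ[k] (h ⊗ₜ[k] lineGen k g))) = h
      rw [DualHW.contract_of, lineCounit_lineGen hg, one_smul])
    (by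
      apply TensorProduct.ext_threefold'
      intro a h w
      change DualHW.of (lineCounit k g ⊗ₜ[k] (DualHW.contract (DualHW.of (a ⊗ₜ[k] (h ⊗ₜ[k] w)))
        ⊗ₜ[k] lineGen k g)) = DualHW.of (a ⊗ₜ[k] (h ⊗ₜ[k] w))
      rw [DualHW.contract_of]
      conv_rhs => rw [← lineCounit_smul_lineGen hg w, ← apply_lineGen_smul_lineCounit hg a]
      conv_lhs => rw [← apply_lineGen_smul_lineCounit hg a]
      rw [LinearMap.smul_apply, smul_eq_mul, TensorProduct.smul_tmul, TensorProduct.smul_tmul,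
        ← TensorProduct.tmul_smul, smul_smul])

@[simp]
theorem contractEquiv_apply (hg : counit (R := k) g = 1) (x : DualHW k H (k ∙ g)) :
    contractEquiv hg x = DualHW.contract x := rfl

theorem contractEquiv_symm_apply (hg : counit (R := k) g = 1) (h : H) :
    (contractEquiv hg).symm h =
      DualHW.of (lineCounit k g ⊗ₜ[k] (h ⊗ₜ[k] lineGen k g)) := rfl

theorem contract_mul (hg : counit (R := k) g = 1) (x y : DualHW k H (k ∙ g)) :
    DualHW.contract (x * y) = DualHW.contract y * DualHW.contract x := by
  obtain ⟨a, rfl⟩ := (contractEquiv hg).symm.surjective x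
  obtain ⟨b, rfl⟩ := (contractEquiv hg).symm.surjective y
  rw [contractEquiv_symm_apply, contractEquiv_symm_apply, DualHW.tmul_mul_tmul, DualHW.contract_of,
    DualHW.contract_of, DualHW.contract_of, map_smul, lineCounit_lineGen hg]
  simp

theorem contract_one (hg : counit (R := k) g = 1) :
    DualHW.contract (1 : DualHW k H (k ∙ g)) = 1 := by
  obtain ⟨x, hx⟩ := (contractEquiv hg).surjective (1 : H)
  have h1 := contract_mul hg 1 x
  rw [one_mul, show DualHW.contract x = 1 from hx, one_mul] at h1
  exact h1.symm

/-- An element of W* ⊗ H ⊗ W with contraction h corresponds to the map w ↦ h ⊗ w on the line, and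
this map is colinear when h · (g ⊗ 1) = g ⊗ h in H ⊗ H. -/
theorem mem_NLine_iff (hg : counit (R := k) g = 1) (x : DualHW k H (k ∙ g)) :
    x ∈ NLine k g ↔ DualHW.contract x ∈ adStabilizer k g := by
  refine ⟨fun hx => contract_mem_adStabilizer g ⟨x, hx⟩, fun hx => ?_⟩
  change DualHW.of.symm x ∈ cotensor (dualCoaction (lineCoaction k g))
    (freeCoaction (lineCoaction k g))
  rw [mem_cotensor_iff]
  intro w
  obtain ⟨h, rfl⟩ := (contractEquiv hg).symm.surjective x
  rw [← contractEquiv_apply hg, LinearEquiv.apply_symm_apply, mem_adStabilizer] at hx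
  have h1 : ∀ w, DualHW.toHom ((contractEquiv hg).symm h) w = h ⊗ₜ w := fun w => by
    rw [contractEquiv_symm_apply]
    change lineCounit k g w • (h ⊗ₜ[k] lineGen k g) = h ⊗ₜ w
    rw [← TensorProduct.tmul_smul, lineCounit_smul_lineGen hg]
  rw [h1, freeCoaction_tmul, lineCoaction, TensorProduct.mk_apply, LinearMap.lTensor_tmul,
    LinearMap.lTensor_tmul, h1]
  have h2 : (g ⊗ₜ[k] (TensorProduct.mk k H (k ∙ g) 1) w) =
      ((TensorProduct.mk k H (k ∙ g)).flip w).lTensor H (g ⊗ₜ[k] (1 : H)) := rfl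
  rw [h2, ← diagAction_lTensor _ (fun h x => by
    simp [TensorProduct.smul_tmul']), diagAction_tmul_mul, hx]
  simp

/-- The algebra `N_W` for `W = k g` is opposite to the stabilizer of `g`. -/
def NLineEquiv (hg : counit (R := k) g = 1) : NLine k g ≃ₐ[k] (adStabilizer k g)ᵐᵒᵖ :=
  AlgEquiv.ofBijective
    (AlgHom.ofLinearMap
      ((MulOpposite.opLinearEquiv k).toLinearMap ∘ₗ
        (DualHW.contract ∘ₗ (Subalgebra.toSubmodule (NLine k g)).subtype).codRestrict
          (Subalgebra.toSubmodule (adStabilizer k g)) (fun x => contract_mem_adStabilizer g x))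
      (MulOpposite.unop_injective (Subtype.ext (contract_one hg)))
      (fun x y => MulOpposite.unop_injective (Subtype.ext (contract_mul hg _ _))))
    (by
      constructor
      · intro x y hxy
        have := congrArg (fun z => ((MulOpposite.unop z : adStabilizer k g) : H)) hxy
        exact Subtype.ext ((contractEquiv hg).injective this)
      · intro b
        refine ⟨⟨(contractEquiv hg).symm (b.unop : adStabilizer k g), ?_⟩, ?_⟩
        · rw [mem_NLine_iff hg, ← contractEquiv_apply hg, LinearEquiv.apply_symm_apply]
          exact b.unop.2
        · exact MulOpposite.unop_injective
            (Subtype.ext ((contractEquiv hg).apply_symm_apply (b.unop : adStabilizer k g).1)))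

theorem NLineEquiv_apply (hg : counit (R := k) g = 1) (x : NLine k g) :
    ((NLineEquiv hg x).unop : H) = DualHW.contract (x : DualHW k H (k ∙ g)) := rfl

/-- The algebra isomorphism between the opposite of `N_W` and the stabilizer of `g`. -/
def opNLineEquiv (hg : counit (R := k) g = 1) : (NLine k g)ᵐᵒᵖ ≃ₐ[k] adStabilizer k g :=
  AlgEquiv.opComm (NLineEquiv hg)

theorem opNLineEquiv_apply (hg : counit (R := k) g = 1) (x : (NLine k g)ᵐᵒᵖ) :
    (opNLineEquiv hg x : H) = DualHW.contract (x.unop : DualHW k H (k ∙ g)) := rfl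

/-- The stabilizer of `g` is a right coideal. -/
theorem comul_mem_adStabilizer {h : H} (hh : h ∈ adStabilizer k g) : comul (R := k) h ∈
    LinearMap.range ((Subalgebra.toSubmodule (adStabilizer k g)).subtype.rTensor H) := by
  let f : H →ₗ[k] H ⊗[k] H :=
    ((adAction k).toLinearMap.flip g).rTensor H ∘ₗ comul - TensorProduct.mk k H H g
  -- The stabilizer is the kernel of f and H is flat over k, so it suffices that f ⊗ id kills Δ(h).
  -- By coassociativity that is Δ applied to the second leg of the defining equation of the
  -- stabilizer.
  have hex : Function.Exact (Subalgebra.toSubmodule (adStabilizer k g)).subtype f := by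
    intro x
    rw [LinearMap.sub_apply, sub_eq_zero]
    exact ⟨fun hx => ⟨⟨x, hx⟩, rfl⟩, by rintro ⟨y, rfl⟩; exact y.2⟩
  refine ((Module.Flat.rTensor_exact H hex) (comul h)).1 ?_
  apply (TensorProduct.assoc k H H H).injective
  rw [mem_adStabilizer] at hh
  rw [map_zero, LinearMap.rTensor_sub, LinearMap.sub_apply, map_sub, sub_eq_zero]
  have h1 : ∀ t : H ⊗[k] H, TensorProduct.assoc k H H H
      ((((adAction k).toLinearMap.flip g).rTensor H ∘ₗ comul).rTensor H t) =
      ((adAction k).toLinearMap.flip g).rTensor (H ⊗[k] H)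
        (TensorProduct.assoc k H H H ((comul (R := k)).rTensor H t)) := fun t => by
    induction t with
    | zero => simp
    | add x y hx hy => simp only [map_add, hx, hy]
    | tmul x y =>
      simp only [LinearMap.rTensor_tmul, LinearMap.comp_apply]
      generalize comul (R := k) x = d
      induction d with
      | zero => simp
      | add x y hx hy => simp only [map_add, add_tmul, hx, hy]
      | tmul x y => simp
  have h2 : ∀ t : H ⊗[k] H, TensorProduct.assoc k H H H
      ((TensorProduct.mk k H H g).rTensor H t) = g ⊗ₜ t := fun t => by
    induction t with
    | zero => simp
    | add x y hx hy => simp only [map_add, tmul_add, hx, hy]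
    | tmul x y => simp
  rw [h1, h2, Coalgebra.coassoc_apply, ← LinearMap.comp_apply, LinearMap.rTensor_comp_lTensor,
    ← LinearMap.lTensor_comp_rTensor, LinearMap.comp_apply, hh, LinearMap.lTensor_tmul]

end Line

/-! ### Coinvariants -/

section Projection

variable {k H : Type*} [Field k] [Ring H] [HopfAlgebra k H] {g : H} {V : Type*} [AddCommGroup V]
  [Module k V] {ρ : V →ₗ[k] H ⊗[k] V}

/-- The map `v ↦ ∑ θ(v⁻¹) v⁰`. -/
def coinvProj (θ : Module.Dual k H) (ρ : V →ₗ[k] H ⊗[k] V) : V →ₗ[k] V :=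
  (TensorProduct.lid k V).toLinearMap ∘ₗ θ.rTensor V ∘ₗ ρ

theorem coinvProj_apply (θ : Module.Dual k H) (v : V) :
    coinvProj θ ρ v = TensorProduct.lid k V (θ.rTensor V (ρ v)) := rfl

theorem coinvProj_of_coinv {θ : Module.Dual k H} (hθ : θ g = 1) {v : V} (hv : ρ v = g ⊗ₜ v) :
    coinvProj θ ρ v = v := by
  rw [coinvProj_apply, hv]
  simp [hθ]

theorem coinvProj_mem {P : Submodule k V} (θ : Module.Dual k H) {v : V}
    (hv : ρ v ∈ LinearMap.range (P.subtype.lTensor H)) : coinvProj θ ρ v ∈ P := by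
  obtain ⟨t, ht⟩ := hv
  rw [coinvProj_apply, ← ht]
  clear ht
  induction t with
  | zero => simp
  | add a b ha hb => simp only [map_add]; exact P.add_mem ha hb
  | tmul a b => simpa using P.smul_mem _ b.2

end Projection

section Coinvariants

variable {k H : Type*} [Field k] [Ring H] [HopfAlgebra k H] {R : H ⊗[k] H} {D : Submodule k H}
  {g : H} {V : Type*} [AddCommGroup V] [Module k V] [Module H V] [IsScalarTower k H V]
  {ρ : V →ₗ[k] H ⊗[k] V}

theorem diagAction_tmul (h : H) (x : V) : diagAction k V h (g ⊗ₜ x) =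
    TensorProduct.map ((adAction k).toLinearMap.flip g)
      ((LinearMap.toSpanSingleton H V x).restrictScalars k) (comul h) := by
  simp only [diagAction, AlgHom.comp_apply, Bialgebra.comulAlgHom_apply]
  generalize comul (R := k) h = d
  induction d with
  | zero => simp
  | add a b ha hb => simp only [map_add, LinearMap.add_apply, ha, hb]
  | tmul a b => simp [Module.endTensorEndAlgHom_apply]

theorem diagAction_tmul_eq_lTensor (h : H) (x : V) : diagAction k V h (g ⊗ₜ x) =
    ((LinearMap.toSpanSingleton H V x).restrictScalars k).lTensor H
      (diagAction k H h (g ⊗ₜ 1)) := by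
  rw [diagAction_lTensor _ (fun h x => by simp [mul_smul])]
  simp

/-- An `H`-module with an `H`-linear coaction which is generated by elements with `ρ(x) = g ⊗ x` is
an object of `^D_H M`. -/
theorem isObject_of_span_eq_top (hR : IsQuasitriangular R) (hg : IsTransmutedGroupLike R g)
    (hD : LinearMap.range ((adAction k).toLinearMap.flip g) ≤ D)
    (hρ : ∀ (h : H) (v : V), ρ (h • v) = diagAction k V h (ρ v))
    (hV : Submodule.span H {x | ρ x = g ⊗ₜ x} = ⊤) : IsObject R D ρ := by
  -- Additivity reduces each axiom to h • x with x coinvariant, where ρ(h x) = ∑ (h₁ · g) ⊗ h₂ x;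
  -- the axioms then follow from those of Δ and ε.
  have key : ∀ {p : V → Prop}, p 0 → (∀ x y, p x → p y → p (x + y)) →
      (∀ (h : H) (x : V), ρ x = g ⊗ₜ x → p (h • x)) → ∀ v, p v := by
    intro p h0 hadd hsm v
    have hv : v ∈ Submodule.span H {x | ρ x = g ⊗ₜ x} := by rw [hV]; trivial
    rw [← Set.image_id {x | ρ x = g ⊗ₜ x}, Finsupp.mem_span_image_iff_linearCombination] at hv
    obtain ⟨c, hc, rfl⟩ := hv
    rw [Finsupp.linearCombination_apply, Finsupp.sum]
    exact Finset.sum_induction _ p hadd h0 fun x hx => hsm _ _ (hc hx)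
  refine ⟨?_, ?_, ?_, hρ⟩
  · refine key (by simp) (fun x y hx hy => by simp only [map_add, hx, hy]) fun h x hx => ?_
    rw [hρ, hx, diagAction_tmul]
    have h1 : ∀ t : H ⊗[k] H, TensorProduct.assoc k H H V ((transmutedComul R).rTensor V
        (TensorProduct.map ((adAction k).toLinearMap.flip g)
          ((LinearMap.toSpanSingleton H V x).restrictScalars k) t)) =
        TensorProduct.map ((adAction k).toLinearMap.flip g)
          (TensorProduct.map ((adAction k).toLinearMap.flip g)
            ((LinearMap.toSpanSingleton H V x).restrictScalars k))
          (TensorProduct.assoc k H H H ((comul (R := k)).rTensor H t)) := fun t => by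
      induction t with
      | zero => simp
      | add x y hx hy => simp only [map_add, hx, hy]
      | tmul a b =>
        simp only [TensorProduct.map_tmul, LinearMap.rTensor_tmul, LinearMap.flip_apply,
          AlgHom.toLinearMap_apply, transmutedComul_adAction_groupLike hR hg]
        generalize comul (R := k) a = d
        induction d with
        | zero => simp
        | add x y hx hy => simp only [map_add, add_tmul, hx, hy]
        | tmul x y => simp
    have h2 : ∀ t : H ⊗[k] H, ρ.lTensor H (TensorProduct.map ((adAction k).toLinearMap.flip g)
          ((LinearMap.toSpanSingleton H V x).restrictScalars k) t) =
        TensorProduct.map ((adAction k).toLinearMap.flip g)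
          (TensorProduct.map ((adAction k).toLinearMap.flip g)
            ((LinearMap.toSpanSingleton H V x).restrictScalars k))
          ((comul (R := k)).lTensor H t) := fun t => by
      induction t with
      | zero => simp
      | add x y hx hy => simp only [map_add, hx, hy]
      | tmul a b => simp [hρ, hx, diagAction_tmul]
    rw [h1, h2, Coalgebra.coassoc_apply]
  · refine key (by simp) (fun x y hx hy => by simp only [map_add, hx, hy]) fun h x hx => ?_
    rw [hρ, hx, diagAction_tmul]
    have h1 : ∀ t : H ⊗[k] H, TensorProduct.lid k V ((counit (R := k)).rTensor V
        (TensorProduct.map ((adAction k).toLinearMap.flip g)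
          ((LinearMap.toSpanSingleton H V x).restrictScalars k) t)) =
        TensorProduct.lid k H ((counit (R := k)).rTensor H t) • x := fun t => by
      induction t with
      | zero => simp
      | add x y hx hy => simp only [map_add, add_smul, hx, hy]
      | tmul a b => simp [hg.1]
    rw [h1, Coalgebra.rTensor_counit_comul]
    simp
  · refine key (by simp) (fun x y hx hy => by rw [map_add]; exact Submodule.add_mem _ hx hy)
      fun h x hx => ?_
    rw [hρ, hx, diagAction_tmul]
    generalize comul (R := k) h = d
    induction d with
    | zero => simp
    | add a b ha hb => rw [map_add]; exact Submodule.add_mem _ ha hb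
    | tmul a b => exact ⟨⟨_, hD ⟨a, rfl⟩⟩ ⊗ₜ (b • x), rfl⟩

/-- The functional `θ` defines a projection onto the coinvariants. -/
theorem IsObject.apply_coinvProj (hρ : IsObject R D ρ) {θ : Module.Dual k H}
    (hθ : ∀ d ∈ D, TensorProduct.lid k H (θ.rTensor H (transmutedComul R d)) = θ d • g) (v : V) :
    ρ (coinvProj θ ρ v) = g ⊗ₜ coinvProj θ ρ v := by
  have h1 : ∀ t : H ⊗[k] V, ρ (TensorProduct.lid k V (θ.rTensor V t)) =
      TensorProduct.lid k _ (θ.rTensor _ (ρ.lTensor H t)) := fun t => by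
    induction t with
    | zero => simp
    | add a b ha hb => simp only [map_add, ha, hb]
    | tmul a b => simp
  -- Coassociativity replaces ∑ θ(v⁻²) v⁻¹ ⊗ v⁰ by (θ ⊗ id)Δ_R applied to v⁻¹, which lies in D,
  -- where the hypothesis on θ applies.
  rw [coinvProj_apply, h1, ← hρ.coassoc]
  obtain ⟨t, ht⟩ := hρ.mem v
  rw [← ht]
  clear ht
  induction t with
  | zero => simp
  | add a b ha hb => simp only [map_add, tmul_add, ha, hb]
  | tmul d v =>
    have h2 : ∀ s : H ⊗[k] H, TensorProduct.lid k _ (θ.rTensor _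
        (TensorProduct.assoc k H H V (s ⊗ₜ v))) =
        TensorProduct.lid k H (θ.rTensor H s) ⊗ₜ v := fun s => by
      induction s with
      | zero => simp
      | add a b ha hb => simp only [map_add, add_tmul, ha, hb]
      | tmul a b => simp [TensorProduct.smul_tmul']
    simp only [LinearMap.rTensor_tmul, h2, Submodule.subtype_apply, hθ d d.2]
    simp [TensorProduct.smul_tmul', TensorProduct.tmul_smul]

variable (k) in
/-- The coaction `h ↦ ∑ (h₁ ·_ad g) ⊗ h₂` of `H`. -/
def regularCoaction (g : H) : H →ₗ[k] H ⊗[k] H :=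
  ((adAction k).toLinearMap.flip g).rTensor H ∘ₗ comul

theorem regularCoaction_eq_diagAction (h : H) :
    regularCoaction k g h = diagAction k H h (g ⊗ₜ 1) := by
  rw [diagAction_tmul_mul]
  simp [regularCoaction]

theorem isObject_regularCoaction (hR : IsQuasitriangular R) (hg : IsTransmutedGroupLike R g)
    (hD : LinearMap.range ((adAction k).toLinearMap.flip g) ≤ D) :
    IsObject R D (regularCoaction k g) := by
  refine isObject_of_span_eq_top hR hg hD (fun h v => ?_) ?_
  · rw [regularCoaction_eq_diagAction, regularCoaction_eq_diagAction, smul_eq_mul, map_mul,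
      Module.End.mul_apply]
  · rw [Submodule.eq_top_iff']
    intro h
    rw [← mul_one h, ← smul_eq_mul]
    refine Submodule.smul_mem _ _ (Submodule.subset_span ?_)
    rw [Set.mem_ofPred_eq, regularCoaction_eq_diagAction, map_one, Module.End.one_apply]

/-- On the multiples of a coinvariant the projection is given by the projection of `H`. -/
theorem coinvProj_smul (hρ : ∀ (h : H) (v : V), ρ (h • v) = diagAction k V h (ρ v))
    (θ : Module.Dual k H) (h : H) {v : V} (hv : ρ v = g ⊗ₜ v) :
    coinvProj θ ρ (h • v) = coinvProj θ (regularCoaction k g) h • v := by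
  rw [coinvProj_apply, coinvProj_apply, hρ, hv, diagAction_tmul_eq_lTensor,
    regularCoaction_eq_diagAction]
  generalize diagAction k H h (g ⊗ₜ 1) = t
  induction t with
  | zero => simp
  | add a b ha hb => simp only [map_add, add_smul, ha, hb]
  | tmul a b => simp

end Coinvariants

/-! ### Coinvariants generate -/

section Generation

variable {k H : Type*} [Field k] [Ring H] [HopfAlgebra k H] {R : H ⊗[k] H} {D : Submodule k H}
  {g : H} {V : Type*} [AddCommGroup V] [Module k V] [Module H V] [IsScalarTower k H V]
  {ρ : V →ₗ[k] H ⊗[k] V}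

/-- `∑ h₁ θ(S(h₂)₁ · d) S(h₂)₂ = θ(S(h) · d) 1`. -/
theorem lift_mul_antipode (θ : Module.Dual k H) (d h : H) :
    LinearMap.mul' k H (LinearMap.lTensor H
      ((TensorProduct.lid k H).toLinearMap ∘ₗ
        (θ ∘ₗ (adAction k).toLinearMap.flip d).rTensor H ∘ₗ comul ∘ₗ antipode k) (comul h)) =
      θ (adAction k (antipode k h) d) • 1 := by
  let T : WithConv (H →ₗ[k] H) := toConv (LinearMap.toSpanSingleton k H 1 ∘ₗ
    θ ∘ₗ (adAction k).toLinearMap.flip d ∘ₗ antipode k)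
  -- Since Δ(S(x)) = ∑ S(x₂) ⊗ S(x₁), the inner factor is S convolved with the scalar-valued map T,
  -- and id * S = 1 removes it.
  have h1 : convInvHom (AlgHom.id k H) * T = toConv ((TensorProduct.lid k H).toLinearMap ∘ₗ
        (θ ∘ₗ (adAction k).toLinearMap.flip d).rTensor H ∘ₗ comul ∘ₗ antipode k) := by
    ext x
    change (convInvHom (AlgHom.id k H) * T) x = TensorProduct.lid k H
      ((θ ∘ₗ (adAction k).toLinearMap.flip d).rTensor H (comul (antipode k x)))
    rw [LinearMap.convMul_apply, comul_antipode]
    generalize comul (R := k) x = c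
    induction c with
    | zero => simp
    | add x y hx hy => simp only [map_add, hx, hy]
    | tmul x y => simp [T, convInvHom]
  have h2 : convHom (AlgHom.id k H) * (convInvHom (AlgHom.id k H) * T) = T := by
    rw [← mul_assoc, convHom_mul_convInvHom, one_mul]
  have h3 := congrArg (fun f => f h) h2
  rw [h1] at h3
  exact h3

/-- This is ∑ h₁ E_V(S(h₂) v) = ∑ θ(S(h) · v⁻¹) v⁰. It exhibits the right-hand side as an element of
the H-module generated by coinvariants. -/
theorem coinvProj_antipode (hρ : ∀ (h : H) (v : V), ρ (h • v) = diagAction k V h (ρ v))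
    (θ : Module.Dual k H) (h : H) (v : V) :
    TensorProduct.lift ((Algebra.lsmul k k V : H →ₐ[k] _).toLinearMap)
      (LinearMap.lTensor H (coinvProj θ ρ ∘ₗ
        (LinearMap.toSpanSingleton H V v).restrictScalars k ∘ₗ antipode k) (comul h)) =
      TensorProduct.lid k V ((θ ∘ₗ adAction k (antipode k h)).rTensor V (ρ v)) := by
  have h1 : ∀ t : H ⊗[k] V, TensorProduct.lift ((Algebra.lsmul k k V : H →ₐ[k] _).toLinearMap)
      (LinearMap.lTensor H ((TensorProduct.lid k V).toLinearMap ∘ₗ θ.rTensor V ∘ₗ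
        (diagAction k V).toLinearMap.flip t ∘ₗ antipode k) (comul h)) =
      TensorProduct.lid k V ((θ ∘ₗ adAction k (antipode k h)).rTensor V t) := fun t => by
    induction t with
    | zero => simp
    | add a b ha hb =>
      simp only [map_add, LinearMap.add_comp, LinearMap.comp_add, LinearMap.lTensor_add,
        LinearMap.add_apply] at ha hb ⊢
      rw [ha, hb]
    | tmul d x =>
      have h2 := congrArg (fun z : H => z • x) (lift_mul_antipode θ d h)
      simp only [smul_assoc, one_smul] at h2
      rw [LinearMap.rTensor_tmul, TensorProduct.lid_tmul]
      refine Eq.trans ?_ h2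
      generalize comul (R := k) h = c
      induction c with
      | zero => simp
      | add a b ha hb => simp only [map_add, add_smul, ha, hb]
      | tmul a b =>
        simp only [LinearMap.lTensor_tmul, LinearMap.comp_apply, LinearMap.flip_apply,
          AlgHom.toLinearMap_apply, diagAction_tmul, TensorProduct.lift.tmul, Algebra.lsmul_coe,
          LinearMap.mul'_apply, mul_smul]
        congr 1
        generalize comul (R := k) (antipode k b) = c
        induction c with
        | zero => simp
        | add a b ha hb => simp only [map_add, add_smul, ha, hb]
        | tmul a b => simp
  rw [← h1]
  congr 3
  ext x
  simp [coinvProj_apply, hρ]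

/-- A subobject is generated, as an `H`-module, by its coinvariants. -/
theorem mem_span_coinvariants (hR : IsQuasitriangular R)
    (hD : D = LinearMap.range ((adAction k).toLinearMap.flip g)) (hρ : IsObject R D ρ)
    {l : Module.Dual k H} (hl1 : l 1 = 1)
    (hlad : ∀ h a : H, l (adAction k h a) = counit (R := k) h * l a)
    (hl : ∀ d ∈ D, TensorProduct.lid k H ((lineIntegral R g l).rTensor H (transmutedComul R d)) =
      lineIntegral R g l d • g)
    (P : Submodule H V)
    (hP : ∀ v ∈ P, ρ v ∈ LinearMap.range ((P.restrictScalars k).subtype.lTensor H))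
    {v : V} (hv : v ∈ P) : v ∈ Submodule.span H {x | x ∈ P ∧ ρ x = g ⊗ₜ x} := by
  set Q := Submodule.span H {x | x ∈ P ∧ ρ x = g ⊗ₜ x}
  have h1 : ∀ d ∈ D, ∀ x ∈ P, TensorProduct.lid k V
      ((l ∘ₗ LinearMap.mulLeft k d ∘ₗ preBraidedAntipode R).rTensor V (ρ x)) ∈ Q := by
    intro d hd x hx
    rw [hD] at hd
    obtain ⟨h, rfl⟩ := hd
    -- For d = h · g, invariance of l and equivariance of S_R give l(d S_R(b)) = θ(S(h) · b).
    have h2 : l ∘ₗ LinearMap.mulLeft k ((adAction k).toLinearMap.flip g h) ∘ₗ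
        preBraidedAntipode R = lineIntegral R g l ∘ₗ adAction k (antipode k h) := by
      ext b
      change l (adAction k h g * preBraidedAntipode R b) =
        l (g * preBraidedAntipode R (adAction k (antipode k h) b))
      rw [preBraidedAntipode_adAction hR, adInvariant_mul hlad]
    rw [h2, ← coinvProj_antipode hρ.smul]
    generalize comul (R := k) h = c
    induction c with
    | zero => simp
    | add a b ha hb => rw [map_add, map_add]; exact Q.add_mem ha hb
    | tmul a b =>
      refine Q.smul_mem a (Submodule.subset_span ⟨?_, hρ.apply_coinvProj hl _⟩)
      exact coinvProj_mem (P := P.restrictScalars k) _ (hP _ (P.smul_mem _ hx))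
  obtain ⟨q, hq⟩ := exists_projection D
  obtain ⟨t, ht⟩ := hP v hv
  let Φ : H ⊗[k] V →ₗ[k] V := TensorProduct.lid k V ∘ₗ
    (l ∘ₗ LinearMap.mul' k H ∘ₗ (preBraidedAntipode R).lTensor H).rTensor V ∘ₗ
    (TensorProduct.assoc k H H V).symm.toLinearMap ∘ₗ ρ.lTensor H
  have hΦ : ∀ d x, Φ (d ⊗ₜ x) = TensorProduct.lid k V
      ((l ∘ₗ LinearMap.mulLeft k d ∘ₗ preBraidedAntipode R).rTensor V (ρ x)) := fun d x => by
    change TensorProduct.lid k V ((l ∘ₗ LinearMap.mul' k H ∘ₗ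
      (preBraidedAntipode R).lTensor H).rTensor V ((TensorProduct.assoc k H H V).symm
        (d ⊗ₜ ρ x))) = _
    generalize ρ x = s
    induction s with
    | zero => simp
    | add a b ha hb => simp only [map_add, tmul_add, ha, hb]
    | tmul a b => simp
  -- Φ(ρ(v)) = ∑ l(v⁻² S_R(v⁻¹)) v⁰, which is v by the braided antipode axiom, the counit and l(1) =
  -- 1.
  have h3 : Φ (ρ v) = v := by
    change TensorProduct.lid k V ((l ∘ₗ LinearMap.mul' k H ∘ₗ
      (preBraidedAntipode R).lTensor H).rTensor V ((TensorProduct.assoc k H H V).symm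
        (ρ.lTensor H (ρ v)))) = _
    rw [← hρ.coassoc, LinearEquiv.symm_apply_apply]
    conv_rhs => rw [← hρ.counit v]
    generalize ρ v = s
    induction s with
    | zero => simp
    | add a b ha hb => simp only [map_add, ha, hb]
    | tmul a b =>
      simp only [LinearMap.rTensor_tmul, LinearMap.comp_apply,
        mul_preBraidedAntipode_transmutedComul hR]
      simp [hl1]
  -- The coaction lies in D ⊗ V and in H ⊗ P. Projecting the first leg of a representative in H ⊗ P
  -- shows that only terms d ⊗ x with d in D and x in P matter.
  have h4 : (D.subtype ∘ₗ q).rTensor V (ρ v) = ρ v := by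
    obtain ⟨s, hs⟩ := hρ.mem v
    rw [← hs, ← LinearMap.comp_apply, ← LinearMap.rTensor_comp]
    congr 2
    ext d
    simp [hq]
  rw [← h3, ← h4, ← ht]
  clear ht
  induction t with
  | zero => simp
  | add a b ha hb => simp only [map_add]; exact Q.add_mem ha hb
  | tmul a b =>
    rw [LinearMap.lTensor_tmul, LinearMap.rTensor_tmul, hΦ]
    exact h1 _ (q a).2 _ b.2

end Generation

/-! ### Induced objects -/

section Induced

variable {k H : Type*} [Field k] [Ring H] [HopfAlgebra k H] {R : H ⊗[k] H} {D : Submodule k H}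
  {g : H} {U : Type*} [AddCommGroup U] [Module k U] [Module (NLine k g)ᵐᵒᵖ U]

variable (k g) in
/-- The class of `1 ⊗ u` in the induced object. -/
def inducedGen (u : U) : Induced k g U := (inducedRel (k := k) g U).mkQ ((1 : H) ⊗ₜ[k] u)

theorem smul_inducedGen (h : H) (u : U) :
    h • inducedGen k g u = (inducedRel (k := k) g U).mkQ (h ⊗ₜ[k] u) := by
  rw [inducedGen, ← map_smul, TensorProduct.smul_tmul', smul_eq_mul, mul_one]

theorem inducedGen_add (u u' : U) :
    inducedGen k g (u + u') = inducedGen k g u + inducedGen k g u' := by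
  rw [inducedGen, tmul_add, map_add]; rfl

theorem inducedGen_zero : inducedGen k g (0 : U) = 0 := by
  rw [inducedGen, tmul_zero, map_zero]

theorem inducedGen_smul (n : (NLine k g)ᵐᵒᵖ) (u : U) : inducedGen k g (n • u) =
    DualHW.contract (n.unop : DualHW k H (k ∙ g)) • inducedGen k g u := by
  rw [smul_inducedGen]
  refine (Submodule.Quotient.eq _).2 (Submodule.subset_span ⟨1, n.unop, u, ?_⟩)
  simp

theorem induced_induction {p : Induced k g U → Prop} (h0 : p 0)
    (hadd : ∀ x y, p x → p y → p (x + y)) (hsm : ∀ (h : H) (u : U), p (h • inducedGen k g u))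
    (x : Induced k g U) : p x := by
  obtain ⟨z, rfl⟩ := (inducedRel (k := k) g U).mkQ_surjective x
  induction z with
  | zero => rwa [map_zero]
  | add a b ha hb => rw [map_add]; exact hadd _ _ ha hb
  | tmul h u => rw [← smul_inducedGen]; exact hsm h u

theorem inducedCoaction_smul (h : H) (x : Induced k g U) :
    inducedCoaction k g U (h • x) = diagAction k _ h (inducedCoaction k g U x) := by
  obtain ⟨z, rfl⟩ := (inducedRel (k := k) g U).mkQ_surjective x
  rw [← map_smul]
  exact preInducedCoaction_smul g U h z

theorem inducedCoaction_inducedGen (u : U) :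
    inducedCoaction k g U (inducedGen k g u) = g ⊗ₜ inducedGen k g u := by
  change preInducedCoaction g U ((1 : H) ⊗ₜ[k] u) = _
  rw [preInducedCoaction_tmul, Bialgebra.comul_one, Algebra.TensorProduct.one_def]
  simp [inducedGen]

theorem isObject_inducedCoaction (hR : IsQuasitriangular R) (hg : IsTransmutedGroupLike R g)
    (hD : LinearMap.range ((adAction k).toLinearMap.flip g) ≤ D) :
    IsObject R D (inducedCoaction k g U) := by
  refine isObject_of_span_eq_top hR hg hD inducedCoaction_smul ?_
  rw [Submodule.eq_top_iff']
  exact induced_induction (Submodule.zero_mem _) (fun x y => Submodule.add_mem _)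
    fun h u => Submodule.smul_mem _ _ (Submodule.subset_span (inducedCoaction_inducedGen u))

/-- The projection of `H` onto the stabilizer of `g` defined by the functional `θ`. -/
def stabilizerProj (hH : IsObject R D (regularCoaction k g)) {θ : Module.Dual k H}
    (hθ : ∀ d ∈ D, TensorProduct.lid k H (θ.rTensor H (transmutedComul R d)) = θ d • g) :
    H →ₗ[k] adStabilizer k g :=
  (coinvProj θ (regularCoaction k g)).codRestrict (Subalgebra.toSubmodule (adStabilizer k g))
    (hH.apply_coinvProj hθ)

theorem coe_stabilizerProj (hH : IsObject R D (regularCoaction k g)) {θ : Module.Dual k H}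
    (hθ : ∀ d ∈ D, TensorProduct.lid k H (θ.rTensor H (transmutedComul R d)) = θ d • g) (h : H) :
    (stabilizerProj hH hθ h : H) = coinvProj θ (regularCoaction k g) h := rfl

/-- Elements of B are coinvariants of H, so right B-linearity is the formula E_V(h v) = E_H(h) v for
V = H. -/
theorem stabilizerProj_mul (hH : IsObject R D (regularCoaction k g)) {θ : Module.Dual k H}
    (hθ : ∀ d ∈ D, TensorProduct.lid k H (θ.rTensor H (transmutedComul R d)) = θ d • g) (h : H)
    (b : adStabilizer k g) : stabilizerProj hH hθ (h * b) = stabilizerProj hH hθ h * b :=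
  Subtype.ext (coinvProj_smul hH.smul θ h b.2)

/-- The coinvariants of an induced object are the elements `1 ⊗ u`. -/
theorem exists_inducedGen_eq (hg : IsTransmutedGroupLike R g)
    (hH : IsObject R D (regularCoaction k g)) {θ : Module.Dual k H} (hθ1 : θ g = 1)
    (hθ : ∀ d ∈ D, TensorProduct.lid k H (θ.rTensor H (transmutedComul R d)) = θ d • g)
    {x : Induced k g U} (hx : inducedCoaction k g U x = g ⊗ₜ x) :
    ∃ u : U, inducedGen k g u = x := by
  rw [← coinvProj_of_coinv hθ1 hx]
  refine induced_induction (p := fun x => ∃ u : U, inducedGen k g u =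
    coinvProj θ (inducedCoaction k g U) x) ⟨0, ?_⟩ ?_ ?_ x
  · rw [inducedGen_zero, map_zero]
  · rintro x y ⟨u, hu⟩ ⟨v, hv⟩
    exact ⟨u + v, by rw [inducedGen_add, map_add, hu, hv]⟩
  · intro h u
    refine ⟨(opNLineEquiv hg.1).symm (stabilizerProj hH hθ h) • u, ?_⟩
    rw [coinvProj_smul inducedCoaction_smul θ h (inducedCoaction_inducedGen u), inducedGen_smul,
      ← opNLineEquiv_apply hg.1, AlgEquiv.apply_symm_apply, coe_stabilizerProj]

theorem inducedGen_injective [IsScalarTower k (NLine k g)ᵐᵒᵖ U] (hg : IsTransmutedGroupLike R g)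
    (hH : IsObject R D (regularCoaction k g)) {θ : Module.Dual k H} (hθ1 : θ g = 1)
    (hθ : ∀ d ∈ D, TensorProduct.lid k H (θ.rTensor H (transmutedComul R d)) = θ d • g) :
    Function.Injective (inducedGen k g : U → Induced k g U) := by
  -- E(h ⊗ u) = E_H(h) u respects the relations by right B-linearity of E_H and satisfies E(1 ⊗ u) =
  -- u, so it is a retraction of u ↦ 1 ⊗ u.
  let E : H ⊗[k] U →ₗ[k] U := TensorProduct.lift
    ((Algebra.lsmul k k U : (NLine k g)ᵐᵒᵖ →ₐ[k] _).toLinearMap ∘ₗ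
      (opNLineEquiv hg.1).symm.toLinearMap ∘ₗ stabilizerProj hH hθ)
  have hE : ∀ h u, E (h ⊗ₜ u) = (opNLineEquiv hg.1).symm (stabilizerProj hH hθ h) • u :=
    fun h u => rfl
  have h1 : ∀ z ∈ inducedRel (k := k) g U, ∀ h : H, E (h • z) = 0 := by
    intro z hz
    refine Submodule.span_induction (p := fun z _ => ∀ h : H, E (h • z) = 0) ?_ (by simp)
      (fun a b _ _ ha hb h => by rw [smul_add, map_add, ha, hb, add_zero])
      (fun a z _ hz h => by rw [← mul_smul, hz]) hz
    rintro z ⟨a, x, u, rfl⟩ h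
    have h2 : DualHW.contract (x : DualHW k H (k ∙ g)) =
        (opNLineEquiv hg.1 (MulOpposite.op x) : H) := rfl
    rw [smul_sub, TensorProduct.smul_tmul', TensorProduct.smul_tmul', map_sub, hE, hE, smul_eq_mul,
      smul_eq_mul, ← mul_assoc, h2, stabilizerProj_mul,
      map_mul (opNLineEquiv hg.1).symm, AlgEquiv.symm_apply_apply, mul_smul, sub_self]
  have h3 : stabilizerProj hH hθ 1 = 1 :=
    Subtype.ext (coinvProj_of_coinv hθ1 (adStabilizer k g).one_mem)
  intro u u' huu
  have h4 := h1 _ ((Submodule.Quotient.eq _).1 huu) 1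
  rw [one_smul, map_sub, hE, hE, h3, map_one, one_smul, one_smul, sub_eq_zero] at h4
  exact h4

end Induced

/-! ### Irreducible objects -/

section Irreducible

variable {k : Type u} {H : Type v} [Field k] [Ring H] [HopfAlgebra k H] {R : H ⊗[k] H}
  {D : Submodule k H} {g : H}

variable (D) in
/-- A functional on `H` with which the coinvariants of all objects are split off. -/
structure IsSplitting (R : H ⊗[k] H) (g : H) (θ : Module.Dual k H) : Prop where
  apply_self : θ g = 1
  transmutedComul : ∀ d ∈ D, TensorProduct.lid k H (θ.rTensor H (transmutedComul R d)) = θ d • g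
  mem_span : ∀ {V : Type w} [AddCommGroup V] [Module k V] [Module H V] [IsScalarTower k H V]
    {ρ : V →ₗ[k] H ⊗[k] V}, IsObject R D ρ → ∀ P : Submodule H V,
    (∀ v ∈ P, ρ v ∈ LinearMap.range ((P.restrictScalars k).subtype.lTensor H)) →
    ∀ v ∈ P, v ∈ Submodule.span H {x | x ∈ P ∧ ρ x = g ⊗ₜ x}

theorem exists_isSplitting (hss : IsSemisimpleRing H) (hcss : IsCosemisimple k H)
    (hR : IsQuasitriangular R) (hD : D = LinearMap.range ((adAction k).toLinearMap.flip g))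
    (hg : IsTransmutedGroupLike R g) :
    ∃ θ : Module.Dual k H, IsSplitting.{u, v, w} D R g θ := by
  obtain ⟨l, hl1, hl, hlad⟩ := exists_adInvariant_integral k H hcss
  have hθ : ∀ d ∈ D, TensorProduct.lid k H ((lineIntegral R g l).rTensor H
      (transmutedComul R d)) = lineIntegral R g l d • g := by
    intro d hd
    rw [hD] at hd
    obtain ⟨h, rfl⟩ := hd
    rw [LinearMap.flip_apply, AlgHom.toLinearMap_apply,
      transmutedComul_adAction_groupLike hR hg, ← lineIntegral_adAction hR hg hl hlad,
      ← LinearMap.comp_apply, LinearMap.rTensor_comp_map]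
  exact ⟨lineIntegral R g l, lineIntegral_self hR hg hl1, hθ,
    fun hρ P hP v hv => mem_span_coinvariants hR hD hρ hl1 hlad hθ P hP hv⟩

/-- For a subobject P ≠ 0 the elements u with 1 ⊗ u in P form a submodule of U. It is nonzero
because P is generated by coinvariants, all of the form 1 ⊗ u; hence it is U and P is everything. -/
theorem isIrreducible_inducedCoaction (hR : IsQuasitriangular R)
    (hD : LinearMap.range ((adAction k).toLinearMap.flip g) ≤ D)
    (hg : IsTransmutedGroupLike R g) {θ : Module.Dual k H}
    (hθ : IsSplitting.{u, v, max v w} D R g θ)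
    (U : Type w) [AddCommGroup U] [Module k U] [Module (NLine k g)ᵐᵒᵖ U]
    [IsScalarTower k (NLine k g)ᵐᵒᵖ U] (hU : IsSimpleModule (NLine k g)ᵐᵒᵖ U) :
    IsIrreducible (inducedCoaction k g U) := by
  have hH := isObject_regularCoaction hR hg hD
  have hinj := inducedGen_injective (U := U) hg hH hθ.apply_self hθ.transmutedComul
  have := IsSimpleModule.nontrivial (NLine k g)ᵐᵒᵖ U
  refine ⟨hinj.nontrivial, fun P hP => or_iff_not_imp_left.2 fun hP0 => ?_⟩
  let U' : Submodule (NLine k g)ᵐᵒᵖ U :=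
    { carrier := {u | inducedGen k g u ∈ P}
      zero_mem' := by rw [Set.mem_ofPred_eq, inducedGen_zero]; exact P.zero_mem
      add_mem' := fun ha hb => by
        rw [Set.mem_ofPred_eq, inducedGen_add]; exact P.add_mem ha hb
      smul_mem' := fun n u hu => by
        rw [Set.mem_ofPred_eq, inducedGen_smul]; exact P.smul_mem _ hu }
  have hU' : U' ≠ ⊥ := by
    intro h0
    refine hP0 ((Submodule.eq_bot_iff _).2 fun v hv => ?_)
    have h1 := hθ.mem_span (isObject_inducedCoaction hR hg hD) P hP v hv
    rw [← Submodule.mem_bot H, ← Submodule.span_zero_singleton H]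
    refine Submodule.span_mono ?_ h1
    rintro x ⟨hx, hxg⟩
    obtain ⟨u, rfl⟩ := exists_inducedGen_eq hg hH hθ.apply_self hθ.transmutedComul hxg
    have hu : u ∈ U' := hx
    rw [h0, Submodule.mem_bot] at hu
    rw [hu, inducedGen_zero]
    rfl
  have hU1 := (eq_bot_or_eq_top U').resolve_left hU'
  rw [Submodule.eq_top_iff']
  refine induced_induction P.zero_mem (fun x y => P.add_mem) fun h u => P.smul_mem h ?_
  have : u ∈ U' := by rw [hU1]; trivial
  exact this

/-- The `H`-submodule generated by coinvariants is a subobject. -/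
theorem apply_mem_range_span {V : Type*} [AddCommGroup V] [Module k V] [Module H V]
    [IsScalarTower k H V] {ρ : V →ₗ[k] H ⊗[k] V}
    (hρ : ∀ (h : H) (v : V), ρ (h • v) = diagAction k V h (ρ v)) {S : Set V}
    (hS : ∀ x ∈ S, ρ x = g ⊗ₜ x) {v : V} (hv : v ∈ Submodule.span H S) :
    ρ v ∈ LinearMap.range (((Submodule.span H S).restrictScalars k).subtype.lTensor H) := by
  refine Submodule.span_induction (p := fun v _ => ρ v ∈ LinearMap.range
    (((Submodule.span H S).restrictScalars k).subtype.lTensor H)) ?_ ?_ ?_ ?_ hv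
  · intro x hx
    exact ⟨g ⊗ₜ ⟨x, Submodule.subset_span hx⟩, by simp [hS x hx]⟩
  · simp
  · intro x y _ _ hx hy
    rw [map_add]
    exact Submodule.add_mem _ hx hy
  · rintro a x _ ⟨t, ht⟩
    exact ⟨diagAction k (Submodule.span H S) a t, by
      rw [hρ, ← ht]
      exact diagAction_lTensor (Y := V) ((Submodule.span H S).subtype.restrictScalars k)
        (fun h x => rfl) a t⟩

variable {V : Type w} [AddCommGroup V] [Module k V] [Module H V] [IsScalarTower k H V]
  {ρ : V →ₗ[k] H ⊗[k] V} {U : Type*} [AddCommGroup U] [Module k U] [Module (NLine k g)ᵐᵒᵖ U]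

/-- An object is generated by its coinvariants. -/
theorem IsSplitting.span_eq_top {θ : Module.Dual k H} (hθ : IsSplitting.{u, v, w} D R g θ)
    (hρ : IsObject R D ρ) : Submodule.span H {x | ρ x = g ⊗ₜ x} = ⊤ := by
  rw [Submodule.eq_top_iff']
  intro v
  refine Submodule.span_mono (fun x hx => hx.2)
    (hθ.mem_span hρ ⊤ (fun x _ => ⟨((LinearMap.id (R := k)).codRestrict
      ((⊤ : Submodule H V).restrictScalars k) (fun _ => trivial)).lTensor H (ρ x), ?_⟩) v trivial)
  rw [← LinearMap.comp_apply, ← LinearMap.lTensor_comp]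
  exact LinearMap.lTensor_id_apply H V _

theorem exists_ne_zero_of_coinvariants {θ : Module.Dual k H}
    (hθ : IsSplitting.{u, v, w} D R g θ) (hρ : IsObject R D ρ) [Nontrivial V]
    {W : Type*} [AddCommGroup W] [Module k W]
    {j : W →ₗ[k] V} (hjsurj : ∀ v, ρ v = g ⊗ₜ v → ∃ u, j u = v) : ∃ u : W, u ≠ 0 := by
  by_contra! h0
  obtain ⟨v, hv⟩ := exists_ne (0 : V)
  refine hv ?_
  have h1 : v ∈ Submodule.span H {x | ρ x = g ⊗ₜ x} := by rw [hθ.span_eq_top hρ]; trivial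
  rw [← Submodule.mem_bot H, ← Submodule.span_zero_singleton H]
  refine Submodule.span_mono (fun x hx => ?_) h1
  obtain ⟨u, rfl⟩ := hjsurj x hx
  rw [h0 u, map_zero]
  rfl

/-- The coinvariants of an irreducible object are an irreducible `N_W`-module. -/
theorem isSimpleModule_of_coinvariants (hg : IsTransmutedGroupLike R g) {θ : Module.Dual k H}
    (hH : IsObject R D (regularCoaction k g))
    (hθ : IsSplitting.{u, v, w} D R g θ) (hρ : IsObject R D ρ) (hirr : IsIrreducible ρ)
    {j : U →ₗ[k] V} (hj : Function.Injective j) (hjmem : ∀ u, ρ (j u) = g ⊗ₜ j u)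
    (hjsurj : ∀ v, ρ v = g ⊗ₜ v → ∃ u, j u = v)
    (hjsmul : ∀ (n : (NLine k g)ᵐᵒᵖ) u,
      j (n • u) = DualHW.contract (n.unop : DualHW k H (k ∙ g)) • j u) :
    IsSimpleModule (NLine k g)ᵐᵒᵖ U := by
  have hnt := hirr.1
  obtain ⟨u0, hu0⟩ := exists_ne_zero_of_coinvariants hθ hρ hjsurj
  have : Nontrivial U := ⟨u0, 0, hu0⟩
  refine { eq_bot_or_eq_top := fun U' => or_iff_not_imp_left.2 fun hU' => ?_ }
  obtain ⟨u1, hu1, hu10⟩ := (Submodule.ne_bot_iff _).1 hU'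
  -- A nonzero submodule of coinvariants generates a nonzero subobject, hence all of V. Projecting ∑
  -- hᵢ uᵢ to ∑ E_H(hᵢ) uᵢ shows that every coinvariant already lies in the submodule.
  have h1 : Submodule.span H (j '' (U' : Set U)) = ⊤ := by
    refine (hirr.2 _ fun v hv => apply_mem_range_span (g := g) hρ.smul ?_ hv).resolve_left fun h0 => hu10 ?_
    · rintro _ ⟨x, _, rfl⟩
      exact hjmem x
    · have : j u1 ∈ Submodule.span H (j '' (U' : Set U)) := Submodule.subset_span ⟨u1, hu1, rfl⟩
      rw [h0, Submodule.mem_bot] at this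
      exact hj (this.trans (map_zero j).symm)
  have h2 : ∀ v : V, ∃ u ∈ U', j u = coinvProj θ ρ v := by
    intro v
    have hv : v ∈ Submodule.span H (j '' (U' : Set U)) := by rw [h1]; trivial
    rw [Finsupp.mem_span_image_iff_linearCombination] at hv
    obtain ⟨f, hf, rfl⟩ := hv
    rw [Finsupp.linearCombination_apply, Finsupp.sum]
    refine Finset.sum_induction _ (fun v => ∃ u ∈ U', j u = coinvProj θ ρ v) ?_ ?_ ?_
    · rintro x y ⟨a, ha, ha'⟩ ⟨b, hb, hb'⟩
      exact ⟨a + b, U'.add_mem ha hb, by rw [map_add, map_add, ha', hb']⟩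
    · exact ⟨0, U'.zero_mem, by rw [map_zero, map_zero]⟩
    · intro x hx
      refine ⟨(opNLineEquiv hg.1).symm (stabilizerProj hH hθ.transmutedComul (f x)) • x,
        U'.smul_mem _ (hf hx), ?_⟩
      rw [hjsmul, coinvProj_smul hρ.smul θ _ (hjmem x), ← opNLineEquiv_apply hg.1,
        AlgEquiv.apply_symm_apply, coe_stabilizerProj]
  rw [Submodule.eq_top_iff']
  intro u
  obtain ⟨u', hu', h3⟩ := h2 (j u)
  rw [coinvProj_of_coinv hθ.apply_self (hjmem u)] at h3
  rwa [← hj h3]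

/-- The canonical map from the object induced from a module of coinvariants. -/
def fromInduced (j : U →ₗ[k] V)
    (hjsmul : ∀ (n : (NLine k g)ᵐᵒᵖ) u,
      j (n • u) = DualHW.contract (n.unop : DualHW k H (k ∙ g)) • j u) :
    Induced k g U →ₗ[H] V :=
  (inducedRel (k := k) g U).liftQ
    (TensorProduct.AlgebraTensorModule.lift (LinearMap.toSpanSingleton H (U →ₗ[k] V) j)) (by
      refine Submodule.span_le.2 ?_
      rintro _ ⟨h, x, u, rfl⟩
      rw [SetLike.mem_coe, LinearMap.mem_ker, map_sub, sub_eq_zero]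
      change h • j (MulOpposite.op x • u) = (h * DualHW.contract (x : DualHW k H (k ∙ g))) • j u
      rw [hjsmul, mul_smul]
      rfl)

theorem fromInduced_inducedGen (j : U →ₗ[k] V)
    (hjsmul : ∀ (n : (NLine k g)ᵐᵒᵖ) u,
      j (n • u) = DualHW.contract (n.unop : DualHW k H (k ∙ g)) • j u) (u : U) :
    fromInduced j hjsmul (inducedGen k g u) = j u :=
  one_smul H (j u)

theorem lTensor_fromInduced (hρ : ∀ (h : H) (v : V), ρ (h • v) = diagAction k V h (ρ v))
    {j : U →ₗ[k] V} (hjmem : ∀ u, ρ (j u) = g ⊗ₜ j u)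
    (hjsmul : ∀ (n : (NLine k g)ᵐᵒᵖ) u,
      j (n • u) = DualHW.contract (n.unop : DualHW k H (k ∙ g)) • j u) (x : Induced k g U) :
    ((fromInduced j hjsmul).restrictScalars k).lTensor H (inducedCoaction k g U x) =
      ρ (fromInduced j hjsmul x) := by
  refine induced_induction (p := fun x => ((fromInduced j hjsmul).restrictScalars k).lTensor H
    (inducedCoaction k g U x) = ρ (fromInduced j hjsmul x)) (by simp only [map_zero])
    (fun x y hx hy => by simp only [map_add, hx, hy]) (fun h u => ?_) x
  rw [inducedCoaction_smul, inducedCoaction_inducedGen, diagAction_lTensor _ (fun h x => by simp),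
    map_smul, hρ, fromInduced_inducedGen, hjmem, LinearMap.lTensor_tmul,
    LinearMap.restrictScalars_apply, fromInduced_inducedGen]

/-- The canonical map from the object induced from the coinvariants of an irreducible object is
an isomorphism. -/
theorem isomorphic_inducedCoaction {θ : Module.Dual k H}
    (hθ : IsSplitting.{u, v, w} D R g θ) (hρ : IsObject R D ρ) [Nontrivial V]
    {j : U →ₗ[k] V} (hj : Function.Injective j) (hjmem : ∀ u, ρ (j u) = g ⊗ₜ j u)
    (hjsurj : ∀ v, ρ v = g ⊗ₜ v → ∃ u, j u = v)
    (hjsmul : ∀ (n : (NLine k g)ᵐᵒᵖ) u,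
      j (n • u) = DualHW.contract (n.unop : DualHW k H (k ∙ g)) • j u)
    (hX : IsIrreducible (inducedCoaction k g U)) : Isomorphic ρ (inducedCoaction k g U) := by
  let F := fromInduced j hjsmul
  have hFρ := lTensor_fromInduced hρ.smul hjmem hjsmul
  have hsurj : Function.Surjective F := by
    rw [← LinearMap.range_eq_top, eq_top_iff, ← hθ.span_eq_top hρ, Submodule.span_le]
    intro x hx
    obtain ⟨u, rfl⟩ := hjsurj x hx
    exact ⟨inducedGen k g u, fromInduced_inducedGen j hjsmul u⟩
  have hker : LinearMap.ker F = ⊥ := by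
    -- The kernel is a subcomodule by flatness and colinearity of F. It is not everything, since F(1
    -- ⊗ u) = j(u) ≠ 0 for some u.
    refine (hX.2 (LinearMap.ker F) fun x hx => ?_).resolve_right fun h0 => ?_
    · have hex : Function.Exact ((LinearMap.ker F).restrictScalars k).subtype
          (F.restrictScalars k) := fun y =>
        ⟨fun hy => ⟨⟨y, hy⟩, rfl⟩, by rintro ⟨z, rfl⟩; exact z.2⟩
      refine ((Module.Flat.lTensor_exact H hex) _).1 ?_
      rw [hFρ, show fromInduced j hjsmul x = 0 from hx, map_zero]
    · obtain ⟨u, hu⟩ := exists_ne_zero_of_coinvariants hθ hρ hjsurj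
      have h1 : inducedGen k g u ∈ LinearMap.ker F := by rw [h0]; trivial
      have h2 : j u = 0 := (fromInduced_inducedGen j hjsmul u).symm.trans h1
      exact hu (hj (h2.trans (map_zero j).symm))
  let e := LinearEquiv.ofBijective F ⟨LinearMap.ker_eq_bot.1 hker, hsurj⟩
  refine ⟨e.symm, fun v => ?_⟩
  obtain ⟨x, rfl⟩ := hsurj v
  have h3 : e.symm (F x) = x := e.symm_apply_apply x
  rw [h3, ← hFρ, ← LinearMap.comp_apply, ← LinearMap.lTensor_comp]
  have h4 : (e.symm.toLinearMap.restrictScalars k) ∘ₗ ((fromInduced j hjsmul).restrictScalars k) =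
      LinearMap.id := LinearMap.ext fun x => e.symm_apply_apply x
  rw [h4]
  exact LinearMap.lTensor_id_apply H _ _

/-- The coinvariants of an object, as a module over the stabilizer of `g`. -/
def coinvariants (g : H) (ρ : V →ₗ[k] H ⊗[k] V)
    (hρ : ∀ (h : H) (v : V), ρ (h • v) = diagAction k V h (ρ v)) :
    Submodule (adStabilizer k g) V where
  carrier := {v | ρ v = g ⊗ₜ v}
  zero_mem' := by simp
  add_mem' ha hb := by
    rw [Set.mem_ofPred_eq] at *
    rw [map_add, ha, hb, tmul_add]
  smul_mem' b v hv := by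
    rw [Set.mem_ofPred_eq] at *
    change ρ ((b : H) • v) = g ⊗ₜ ((b : H) • v)
    rw [hρ, hv, diagAction_tmul_eq_lTensor, ← regularCoaction_eq_diagAction]
    have := mem_adStabilizer.1 b.2
    rw [regularCoaction, LinearMap.comp_apply, this]
    simp

theorem exists_isomorphic_inducedCoaction (hR : IsQuasitriangular R)
    (hD : LinearMap.range ((adAction k).toLinearMap.flip g) ≤ D)
    (hg : IsTransmutedGroupLike R g) {θ θ' : Module.Dual k H}
    (hθ : IsSplitting.{u, v, w} D R g θ) (hθ' : IsSplitting.{u, v, max v w} D R g θ')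
    (hρ : IsObject R D ρ) (hirr : IsIrreducible ρ) :
    ∃ (U : Type w) (_ : AddCommGroup U) (_ : Module k U) (_ : Module (NLine k g)ᵐᵒᵖ U)
      (_ : IsScalarTower k (NLine k g)ᵐᵒᵖ U),
      IsSimpleModule (NLine k g)ᵐᵒᵖ U ∧ Isomorphic ρ (inducedCoaction k g U) := by
  let c := opNLineEquiv (k := k) (g := g) hg.1
  let U := coinvariants g ρ hρ.smul
  let : Module (NLine k g)ᵐᵒᵖ U := Module.compHom U (c : (NLine k g)ᵐᵒᵖ →+* adStabilizer k g)
  have hc : ∀ (n : (NLine k g)ᵐᵒᵖ) (u : U), n • u = c n • u := fun n u => rfl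
  have htower : IsScalarTower k (NLine k g)ᵐᵒᵖ U := ⟨fun r n u => by
    rw [hc, hc, map_smul, smul_assoc]⟩
  let j : U →ₗ[k] V := (U.restrictScalars k).subtype
  have hj : Function.Injective j := Subtype.val_injective
  have hjmem : ∀ u : U, ρ (j u) = g ⊗ₜ j u := fun u => u.2
  have hjsurj : ∀ v, ρ v = g ⊗ₜ v → ∃ u, j u = v := fun v hv => ⟨⟨v, hv⟩, rfl⟩
  have hjsmul : ∀ (n : (NLine k g)ᵐᵒᵖ) (u : U),
      j (n • u) = DualHW.contract (n.unop : DualHW k H (k ∙ g)) • j u := fun n u => rfl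
  have hsimple := isSimpleModule_of_coinvariants hg (isObject_regularCoaction hR hg hD) hθ hρ hirr
    hj hjmem hjsurj hjsmul
  have hnt := hirr.1
  exact ⟨U, inferInstance, inferInstance, inferInstance, htower, hsimple,
    isomorphic_inducedCoaction hθ hρ hj hjmem hjsurj hjsmul
      (isIrreducible_inducedCoaction hR hD hg hθ' U hsimple)⟩

end Irreducible

end RelYD
end

theorem mainTheorem9 {k : Type u} {H : Type v} [Field k] [Ring H] [HopfAlgebra k H]
    (hss : IsSemisimpleRing H) (hcss : RelYD.IsCosemisimple k H)
    (R : H ⊗[k] H) (hR : RelYD.IsQuasitriangular R)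
    (D : Submodule k H) (hD : RelYD.IsMinimalAdjointStable R D)
    (g : H) (hgD : g ∈ D) (hg : RelYD.IsTransmutedGroupLike R g) :
    -- `N_W`, for `W = k g`, is the right coideal subalgebra `{h : ∑ (h₁ ·_ad g) ⊗ h₂ = g ⊗ h}`;
    -- the product `∘` of `N_W` is opposite to the product of `H`
    (∃ e : RelYD.NLine k g ≃ₐ[k] (RelYD.adStabilizer k g)ᵐᵒᵖ,
      ∀ x : RelYD.NLine k g, ((e x).unop : H) =
        RelYD.DualHW.contract (x : RelYD.DualHW k H (k ∙ g))) ∧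
    (∀ h ∈ RelYD.adStabilizer k g, comul (R := k) h ∈
      LinearMap.range ((Subalgebra.toSubmodule (RelYD.adStabilizer k g)).subtype.rTensor H)) ∧
    -- `U ⊗_{N_W} H` is an object of `^D_H M` for each right `N_W`-module `U`
    (∀ (U : Type w) [AddCommGroup U] [Module k U] [Module (RelYD.NLine k g)ᵐᵒᵖ U]
      [IsScalarTower k (RelYD.NLine k g)ᵐᵒᵖ U],
      RelYD.IsObject R D (RelYD.inducedCoaction k g U)) ∧
    -- it is irreducible if `U` is irreducible
    (∀ (U : Type w) [AddCommGroup U] [Module k U] [Module (RelYD.NLine k g)ᵐᵒᵖ U]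
      [IsScalarTower k (RelYD.NLine k g)ᵐᵒᵖ U],
      IsSimpleModule (RelYD.NLine k g)ᵐᵒᵖ U →
        RelYD.IsIrreducible (RelYD.inducedCoaction k g U)) ∧
    -- each irreducible object of `^D_H M` is isomorphic to such an object
    (∀ (V : Type w) [AddCommGroup V] [Module k V] [Module H V] [IsScalarTower k H V]
      (ρ : V →ₗ[k] H ⊗[k] V), RelYD.IsObject R D ρ → RelYD.IsIrreducible ρ →
      ∃ (U : Type w) (_ : AddCommGroup U) (_ : Module k U) (_ : Module (RelYD.NLine k g)ᵐᵒᵖ U)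
        (_ : IsScalarTower k (RelYD.NLine k g)ᵐᵒᵖ U),
        IsSimpleModule (RelYD.NLine k g)ᵐᵒᵖ U ∧
          RelYD.Isomorphic ρ (RelYD.inducedCoaction k g U)) := by
  have hDr := hD.eq_range hR hgD hg
  obtain ⟨θ, hθ⟩ := RelYD.exists_isSplitting.{u, v, w} hss hcss hR hDr hg
  -- The generation property is needed in two universes: for V itself, and for the induced objects,
  -- which are quotients of H ⊗ U.
  obtain ⟨θ', hθ'⟩ := RelYD.exists_isSplitting.{u, v, max v w} hss hcss hR hDr hg
  exact ⟨⟨RelYD.NLineEquiv hg.1, RelYD.NLineEquiv_apply hg.1⟩,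
    fun h hh => RelYD.comul_mem_adStabilizer hh,
    fun U _ _ _ _ => RelYD.isObject_inducedCoaction hR hg hDr.ge,
    fun U _ _ _ _ hU => RelYD.isIrreducible_inducedCoaction hR hDr.ge hg hθ' U hU,
    fun V _ _ _ _ ρ hρ hirr =>
      RelYD.exists_isomorphic_inducedCoaction hR hDr.ge hg hθ hθ' hρ hirr⟩
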